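/- Let $q\ge 2$ be an integer and consider a regular affine building of type $\tilde A_2$ with parameter $q$: a nonempty simplicial complex which is the union of a family of subcomplexes (apartments), each isomorphic to the Coxeter complex of type $\tilde A_2$ (the triangulated plane whose vertex set is the weight lattice $P=\mathbb Z\lambda_1\oplus\mathbb Z\lambda_2$ of the root system $A_2$, with fundamental weights $\lambda_1,\lambda_2$), such that any two chambers (triangles) lie in a common apartment, between any two apartments with a common chamber there is a unique isomorphism fixing their intersection pointwise, and for every edge $F$ of a chamber $C$ exactly $q$ chambers other than $C$ contain $F$. Fix a vertex $0$, an apartment $A_0$ containing $0$, a chamber $C_0\ni 0$ of $A_0$, and an identification of the vertices of $A_0$ with $P$ under which the vertex $0$ becomes $0\in P$ and $C_0$ becomes $\{0,\lambda_1,\lambda_2\}$. For a vertex $x$, choose an apartment containing $C_0$ and $x$ and map it isomorphically to $A_0$, fixing $C_0$; the radial part of $x$ is the dominant weight $x_1\lambda_1+x_2\lambda_2$ ($x_1,x_2\in\mathbb N$) conjugate, under the finite Weyl group, to the image of $x$. Put $|x|=x_1+x_2$ and $x_1\vee x_2=\max(x_1,x_2)$. Let $V_\lambda(0)$ be the set of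 vertices with radial part $\lambda$, $N_\lambda=|V_\lambda(0)|$, and define $V_\lambda(x)$ likewise around any vertex $x$. Let $q_{t_\lambda}=q^{\sum_{\alpha>0}\langle\lambda,\alpha\rangle}$, so that $q_{t_{\lambda_1}}=q_{t_{\lambda_2}}=q^2$, and $$\rho=\Big(\sum_{i=1}^2 q_{t_{\lambda_i}}^{-1/2}N_{\lambda_i}\Big)^{-1}.$$ Let $p^n(x,y)$ be the $n$-step transition probabilities of the simple random walk on the vertices, given by $p(x,y)=q_{t_{\lambda_i}}^{-1/2}\rho$ if $y\in V_{\lambda_i}(x)$ for some $i\in\{1,2\}$, and $p(x,y)=0$ otherwise. **Theorem.** For every $K>0$ there is a constant $C>0$, depending only on $K$ and $q$, such that for all integers $n\ge 0$ and all vertices $x$ with $n-K\le |x|\le n$ and, writing $d=n-|x|$, with $d\le x_1\vee x_2$, $$\frac1C\, n^d(\rho q^{-1})^n\binom{n-d}{x_1\vee x_2-d}\;\le\; p^n(0,x)\;\le\; C\, n^d(\rho q^{-1})^n\binom{n-d}{x_1\vee x_2-d}$$ (with $0^0=1$). The condition $d\le x_1\vee x_2$ only says that the binomial coefficient is defined;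 it holds automatically when $n\ge 3K$. -/

import Mathlib

noncomputable section

namespace A2

/-! ### The root system of type `A₂` in the basis of the fundamental weights -/

/-- The weight lattice `P = ℤ λ₁ + ℤ λ₂`; the pair `(a, b)` stands for `a λ₁ + b λ₂`.
Since `⟨αᵢ, λⱼ⟩ = δᵢⱼ`, its coordinates are `⟨α₁, ·⟩` and `⟨α₂, ·⟩`. -/
abbrev Weight : Type := ℤ × ℤ

/-- The fundamental weight `λ₁`. -/
def fundWeight₁ : Weight := (1, 0)

/-- The fundamental weight `λ₂`. -/
def fundWeight₂ : Weight := (0, 1)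

/-- The simple reflection `s₁ μ = μ - ⟨μ, α₁⟩ α₁`, where `α₁ = 2 λ₁ - λ₂`. -/
def reflection₁ : Weight ≃ₗ[ℤ] Weight where
  toFun μ := (-μ.1, μ.1 + μ.2)
  invFun μ := (-μ.1, μ.1 + μ.2)
  left_inv μ := by ext <;> simp
  right_inv μ := by ext <;> simp
  map_add' μ ν := by ext <;> simp <;> ring
  map_smul' c μ := by ext <;> simp <;> ring

/-- The simple reflection `s₂ μ = μ - ⟨μ, α₂⟩ α₂`, where `α₂ = 2 λ₂ - λ₁`. -/
def reflection₂ : Weight ≃ₗ[ℤ] Weight where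
  toFun μ := (μ.1 + μ.2, -μ.2)
  invFun μ := (μ.1 + μ.2, -μ.2)
  left_inv μ := by ext <;> simp
  right_inv μ := by ext <;> simp
  map_add' μ ν := by ext <;> simp <;> ring
  map_smul' c μ := by ext <;> simp <;> ring

/-- The Weyl group `W₀`, generated by the two simple reflections. -/
def weylGroup : Subgroup (Weight ≃ₗ[ℤ] Weight) := Subgroup.closure {reflection₁, reflection₂}

/-- The vertices `0, λ₁, λ₂` of the fundamental alcove. -/
def fundAlcove : Finset Weight := {0, fundWeight₁, fundWeight₂}

/-- The Coxeter complex of type `Ã₂`: its vertices are the weights, its chambers are the images of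
the fundamental alcove under the extended affine Weyl group `W₀ ⋉ P`, and its simplices are the
nonempty sets of vertices of a chamber. -/
def coxeterComplex : AbstractSimplicialComplex Weight where
  faces := {s | s.Nonempty ∧ ∃ w ∈ weylGroup, ∃ μ : Weight,
    s ⊆ fundAlcove.image (fun ν => μ + w ν)}
  isRelLowerSet_faces := by
    rintro s ⟨hs, w, hw, μ, h⟩
    exact ⟨hs, fun t hts ht => ⟨ht, w, hw, μ, hts.trans h⟩⟩
  singleton_mem v := by
    refine ⟨Finset.singleton_nonempty v, 1, weylGroup.one_mem, v, ?_⟩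
    rw [Finset.singleton_subset_iff, Finset.mem_image]
    exact ⟨0, by simp [fundAlcove], by simp⟩

/-- `q_{t_μ} = q ^ (∑_{α > 0} ⟨μ, α⟩)`; the positive roots are `α₁`, `α₂` and `α₁ + α₂`. -/
def qTranslation (q : ℕ) (μ : Weight) : ℝ := (q : ℝ) ^ (μ.1 + μ.2 + (μ.1 + μ.2))

/-! ### Simplicial isomorphisms -/

/-- The vertices of a (sub)complex. -/
abbrev Vertex {α : Type*} (K : PreAbstractSimplicialComplex α) : Type _ := {a : α // {a} ∈ K.faces}

/-- An isomorphism of simplicial complexes: a bijection between the vertices that induces a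
bijection between the simplices. -/
structure SimplicialIso {α β : Type*} (K : PreAbstractSimplicialComplex α)
    (L : PreAbstractSimplicialComplex β) where
  /-- the bijection between the vertices -/
  toEquiv : Vertex K ≃ Vertex L
  map_faces : ∀ s : Finset (Vertex K), s.map (Function.Embedding.subtype _) ∈ K.faces ↔
    (s.map toEquiv.toEmbedding).map (Function.Embedding.subtype _) ∈ L.faces

/-! ### Affine buildings of type `Ã₂` -/

/-- An affine building of type `Ã₂` with vertex set `V`, together with its system of apartments.
Its simplices of maximal dimension, the chambers, are those with three vertices. -/
structure Building (V : Type*) where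
  /-- the underlying simplicial complex -/
  complex : AbstractSimplicialComplex V
  /-- the apartments, which are subcomplexes -/
  apartments : Set (PreAbstractSimplicialComplex V)
  nonempty : complex.faces.Nonempty
  apartment_le : ∀ A ∈ apartments, A ≤ complex.toPreAbstractSimplicialComplex
  /-- the building is the union of its apartments -/
  exists_apartment : ∀ s ∈ complex.faces, ∃ A ∈ apartments, s ∈ A.faces
  /-- every apartment is isomorphic to the Coxeter complex -/
  apartment_iso : ∀ A ∈ apartments,
    Nonempty (SimplicialIso A coxeterComplex.toPreAbstractSimplicialComplex)
  /-- any two chambers lie in a common apartment -/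
  exists_common_apartment : ∀ C ∈ complex.faces, C.card = 3 → ∀ D ∈ complex.faces, D.card = 3 →
    ∃ A ∈ apartments, C ∈ A.faces ∧ D ∈ A.faces
  /-- between two apartments with a common chamber there is a unique isomorphism that fixes their
  intersection pointwise -/
  exists_unique_iso : ∀ A ∈ apartments, ∀ A' ∈ apartments,
    (∃ C : Finset V, C.card = 3 ∧ C ∈ A.faces ∧ C ∈ A'.faces) →
      ∃! φ : SimplicialIso A A', ∀ v : Vertex A, {v.1} ∈ A'.faces → (φ.toEquiv v : V) = v

namespace Building

variable {V : Type*} (B : Building V)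

/-- The chambers of the building. -/
def IsChamber (C : Finset V) : Prop := C ∈ B.complex.faces ∧ C.card = 3

/-- The building is regular with parameter `q`: for every chamber `C` and every face `F` of
codimension one of `C` there are exactly `q` chambers different from `C` that contain `F`. -/
def IsRegular (q : ℕ) : Prop :=
  ∀ C : Finset V, B.IsChamber C → ∀ F ⊆ C, F.card = 2 →
    {D : Finset V | B.IsChamber D ∧ D ≠ C ∧ F ⊆ D}.encard = q

/-- A choice, at the vertex `o`, of an apartment `A₀` containing `o`, of a chamber `C₀` of `A₀`
containing `o`, and of an identification of the vertices of `A₀` with the weights, for which `o`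
becomes `0` and `C₀` becomes the fundamental alcove. -/
structure Frame (o : V) where
  /-- the apartment `A₀` -/
  apartment : PreAbstractSimplicialComplex V
  apartment_mem : apartment ∈ B.apartments
  origin_mem : {o} ∈ apartment.faces
  /-- the identification of the vertices of `A₀` with the weights -/
  chart : SimplicialIso apartment coxeterComplex.toPreAbstractSimplicialComplex
  chart_origin : (chart.toEquiv ⟨o, origin_mem⟩ : Weight) = 0
  /-- the chamber `C₀` -/
  chamber : Finset V
  chamber_mem : chamber ∈ apartment.faces
  mem_chamber_iff : ∀ v : Vertex apartment,
    (v : V) ∈ chamber ↔ (chart.toEquiv v : Weight) ∈ fundAlcove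

variable {B}

/-- `μ` is the radial part of `x` (with respect to the frame `f`): `μ` is dominant, and it is
conjugate under `W₀` to the image of `x` by an isomorphism, fixing `C₀`, from an apartment that
contains `C₀` and `x` to the apartment `A₀`. -/
def Frame.IsRadialPart {o : V} (f : B.Frame o) (x : V) (μ : Weight) : Prop :=
  0 ≤ μ.1 ∧ 0 ≤ μ.2 ∧
    ∃ A ∈ B.apartments, f.chamber ∈ A.faces ∧ ∃ hx : {x} ∈ A.faces,
      ∃ φ : SimplicialIso A f.apartment,
        (∀ v : Vertex A, (v : V) ∈ f.chamber → (φ.toEquiv v : V) = v) ∧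
        ∃ w ∈ weylGroup, w (f.chart.toEquiv (φ.toEquiv ⟨x, hx⟩) : Weight) = μ

/-- The sphere `V_μ(o)` of the vertices with radial part `μ`. -/
def Frame.sphere {o : V} (f : B.Frame o) (μ : Weight) : Set V := {x | f.IsRadialPart x μ}

/-- `N_μ`, the cardinality of the sphere `V_μ(o)`. -/
def Frame.sphereCard {o : V} (f : B.Frame o) (μ : Weight) : ℕ := (f.sphere μ).ncard

/-- The normalizing constant `ρ = 1 / ∑ᵢ q_{t_{λᵢ}}^{-1/2} N_{λᵢ}`. -/
def Frame.rho {o : V} (f : B.Frame o) (q : ℕ) : ℝ :=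
  1 / (qTranslation q fundWeight₁ ^ (-(1 / 2) : ℝ) * f.sphereCard fundWeight₁ +
    qTranslation q fundWeight₂ ^ (-(1 / 2) : ℝ) * f.sphereCard fundWeight₂)

open Classical in
/-- The transition probabilities of the simple random walk: `p(x, y) = q_{t_{λᵢ}}^{-1/2} ρ` if
`y ∈ V_{λᵢ}(x)`, and `p(x, y) = 0` if there is no such `i`. The sphere around `x` is taken with
respect to an arbitrary frame at `x`; another frame can at most exchange `λ₁` and `λ₂`, which does
not change the value, as `q_{t_{λ₁}} = q_{t_{λ₂}} = q²`. -/
def Frame.transition {o : V} (f : B.Frame o) (q : ℕ) (x y : V) : ℝ :=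
  if ∃ g : B.Frame x, y ∈ g.sphere fundWeight₁ then
    qTranslation q fundWeight₁ ^ (-(1 / 2) : ℝ) * f.rho q
  else if ∃ g : B.Frame x, y ∈ g.sphere fundWeight₂ then
    qTranslation q fundWeight₂ ^ (-(1 / 2) : ℝ) * f.rho q
  else 0

open Classical in
/-- The `n`-step transition probabilities `pⁿ(x, y)`. -/
def Frame.nStep {o : V} (f : B.Frame o) (q : ℕ) : ℕ → V → V → ℝ
  | 0, x, y => if x = y then 1 else 0
  | n + 1, x, y => ∑' z : V, f.nStep q n x z * f.transition q z y

end Building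

end A2

end

/-!
The walk moves to every neighbour with the same probability `ρ / q`, so `pⁿ(0, x)` is `(ρ / q) ^ n`
times the number of walks of length `n` from `0` to `x` in the graph of the building, and the theorem
is a statement about the order of magnitude of this number.

The retraction onto `A₀` centred at `C₀`, followed by the projection of the weights to the dominant
cone, gives the radial part of every vertex. It is simplicial, and every edge of the cone at the
radial part of `x` lifts to an edge at `x`. The decisive point is `IsRetraction.eq_of_height_lt`: an
edge that leads *towards* the origin lifts in only one way. Since all degrees are bounded
(`exists_neighborFinset`), these properties, collected in `IsRadialGraph`, determine the number of
walks up to constants. Retractions exist because an automorphism of the triangulated plane that fixes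
a chamber is the identity (`eq_self_of_fixes_chamber`).

For the counting, read the walks backwards from `x`, whose radial part is `a λ₁ + b λ₂` with, say,
`b ≤ a`. A walk of length `n = a + b + d` has at most `d` steps that do not lead towards the origin.
Each of them costs a factor `c n`, where `c` bounds the degrees and `n` the positions, and the
remaining steps are a walk in `ℕ × ℕ` with unit weights; this gives `c ^ d * n ^ d` times a binomial
coefficient comparable to `(n - d).choose (a - d)` (`IsRadialGraph.walkCount_le`). Conversely, the
walks with exactly `d` steps `-λ₁ + λ₂`, all others being `-λ₁` or `-λ₂`, which stay in the dominant
cone are counted by a multinomial coefficient times a ballot fraction that is at least `1 / (d + 1)`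
(`IsRadialGraph.le_walkCount`).
-/

noncomputable section

namespace A2

/-! ### Geometry of the weight lattice -/

/-- Two weights are close if they are equal or adjacent in the triangulated plane, that is, if they
lie weakly within distance one with respect to each of the three positive roots. -/
def Close (μ ν : Weight) : Prop :=
  (-1 ≤ μ.1 - ν.1 ∧ μ.1 - ν.1 ≤ 1) ∧ (-1 ≤ μ.2 - ν.2 ∧ μ.2 - ν.2 ≤ 1) ∧
    -1 ≤ μ.1 + μ.2 - (ν.1 + ν.2) ∧ μ.1 + μ.2 - (ν.1 + ν.2) ≤ 1

theorem Close.refl (μ : Weight) : Close μ μ := by unfold Close; omega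

theorem Close.symm {μ ν : Weight} (h : Close μ ν) : Close ν μ := by unfold Close at *; omega

/-- The dominant representative of the Weyl orbit of a weight. Written in the coordinates
`(a + b, b, 0)` of `ℤ³ / ℤ(1, 1, 1)`, it sorts the three coordinates; its own coordinates are
`max - mid` and `mid - min`. -/
def dom (μ : Weight) : Weight :=
  (2 * max 0 (max μ.2 (μ.1 + μ.2)) + min 0 (min μ.2 (μ.1 + μ.2)) - (μ.1 + 2 * μ.2),
    (μ.1 + 2 * μ.2) - max 0 (max μ.2 (μ.1 + μ.2)) - 2 * min 0 (min μ.2 (μ.1 + μ.2)))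

theorem dom_nonneg (μ : Weight) : 0 ≤ (dom μ).1 ∧ 0 ≤ (dom μ).2 := by
  simp only [dom]; omega

theorem dom_of_nonneg {μ : Weight} (h₁ : 0 ≤ μ.1) (h₂ : 0 ≤ μ.2) : dom μ = μ := by
  ext <;> simp only [dom] <;> omega

theorem dom_eq_zero {μ : Weight} (h : dom μ = 0) : μ = 0 := by
  have h₁ := congrArg Prod.fst h
  have h₂ := congrArg Prod.snd h
  simp only [dom, Prod.fst_zero, Prod.snd_zero] at h₁ h₂
  ext
  · simp only [Prod.fst_zero]; omega
  · simp only [Prod.snd_zero]; omega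

theorem Close.dom {μ ν : Weight} (h : Close μ ν) : Close (dom μ) (dom ν) := by
  simp only [Close, A2.dom] at *
  omega

/-- An induction principle for the Weyl group: a property of automorphisms that holds for the
identity and is stable under left multiplication by the simple reflections holds on it. -/
theorem weylGroup_induction {p : (Weight ≃ₗ[ℤ] Weight) → Prop} (h1 : p 1)
    (hr₁ : ∀ w, p w → p (reflection₁ * w)) (hr₂ : ∀ w, p w → p (reflection₂ * w))
    {w : Weight ≃ₗ[ℤ] Weight} (hw : w ∈ weylGroup) : p w := by
  have i₁ : reflection₁⁻¹ = reflection₁ := by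
    rw [inv_eq_iff_mul_eq_one]; ext x <;> simp [reflection₁]
  have i₂ : reflection₂⁻¹ = reflection₂ := by
    rw [inv_eq_iff_mul_eq_one]; ext x <;> simp [reflection₂]
  unfold weylGroup at hw
  refine Subgroup.closure_induction_left (p := fun w _ => p w) h1 ?_ ?_ hw
  · rintro x hx y - hy
    rcases hx with rfl | rfl
    exacts [hr₁ y hy, hr₂ y hy]
  · rintro x hx y - hy
    rcases hx with rfl | rfl
    · rw [i₁]; exact hr₁ y hy
    · rw [i₂]; exact hr₂ y hy

theorem close_weyl_iff {w : Weight ≃ₗ[ℤ] Weight} (hw : w ∈ weylGroup) (μ ν : Weight) :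
    Close (w μ) (w ν) ↔ Close μ ν := by
  refine weylGroup_induction (p := fun w => Close (w μ) (w ν) ↔ Close μ ν) Iff.rfl ?_ ?_ hw
  · intro w h
    rw [← h]
    simp only [Close, LinearEquiv.mul_apply, reflection₁, LinearEquiv.coe_mk, LinearMap.coe_mk,
      AddHom.coe_mk]
    omega
  · intro w h
    rw [← h]
    simp only [Close, LinearEquiv.mul_apply, reflection₂, LinearEquiv.coe_mk, LinearMap.coe_mk,
      AddHom.coe_mk]
    omega

theorem dom_weyl {w : Weight ≃ₗ[ℤ] Weight} (hw : w ∈ weylGroup) (μ : Weight) :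
    dom (w μ) = dom μ := by
  refine weylGroup_induction (p := fun w => dom (w μ) = dom μ) rfl ?_ ?_ hw
  · intro w h
    rw [← h]
    ext <;> simp only [dom, LinearEquiv.mul_apply, reflection₁, LinearEquiv.coe_mk,
      LinearMap.coe_mk, AddHom.coe_mk] <;> omega
  · intro w h
    rw [← h]
    ext <;> simp only [dom, LinearEquiv.mul_apply, reflection₂, LinearEquiv.coe_mk,
      LinearMap.coe_mk, AddHom.coe_mk] <;> omega

theorem reflection₁_mem : reflection₁ ∈ weylGroup := Subgroup.subset_closure (by simp)

theorem reflection₂_mem : reflection₂ ∈ weylGroup := Subgroup.subset_closure (by simp)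

/-- Every weight is conjugate to its dominant representative. -/
theorem exists_weyl_dom (μ : Weight) : ∃ w ∈ weylGroup, w μ = dom μ := by
  by_contra hc
  have key : ∀ w ∈ weylGroup, ¬ (0 ≤ (w μ).1 ∧ 0 ≤ (w μ).2) := fun w hw h =>
    hc ⟨w, hw, by rw [← dom_weyl hw, dom_of_nonneg h.1 h.2]⟩
  have m₁ := reflection₁_mem
  have m₂ := reflection₂_mem
  have k1 := key 1 (one_mem _)
  have k2 := key _ m₁
  have k3 := key _ m₂
  have k4 := key _ (mul_mem m₁ m₂)
  have k5 := key _ (mul_mem m₂ m₁)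
  have k6 := key _ (mul_mem m₁ (mul_mem m₂ m₁))
  simp only [LinearEquiv.mul_apply, LinearEquiv.coe_one, id, reflection₁, reflection₂,
    LinearEquiv.coe_mk, LinearMap.coe_mk, AddHom.coe_mk] at k1 k2 k3 k4 k5 k6
  omega

/-- The triangle with vertices `μ`, `μ + λ₁`, `μ + λ₂`. -/
def upTriangle (μ : Weight) : Finset Weight := {μ, (μ.1 + 1, μ.2), (μ.1, μ.2 + 1)}

/-- The triangle with vertices `μ + λ₁`, `μ + λ₂`, `μ + λ₁ + λ₂`. -/
def downTriangle (μ : Weight) : Finset Weight :=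
  {(μ.1 + 1, μ.2), (μ.1, μ.2 + 1), (μ.1 + 1, μ.2 + 1)}

/-- A nonempty set of pairwise close weights lies in a triangle, based at its least coordinates. -/
theorem exists_subset_triangle {s : Finset Weight} (hs : s.Nonempty)
    (h : ∀ μ ∈ s, ∀ ν ∈ s, Close μ ν) : ∃ μ, s ⊆ upTriangle μ ∨ s ⊆ downTriangle μ := by
  obtain ⟨a, ha, ha'⟩ := s.exists_min_image Prod.fst hs
  obtain ⟨b, hb, hb'⟩ := s.exists_min_image Prod.snd hs
  refine ⟨(a.1, b.2), ?_⟩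
  have hab := h a ha b hb
  by_cases hm : (a.1 + 1, b.2 + 1) ∈ s
  · right
    intro μ hμ
    have h1 := ha' μ hμ
    have h2 := hb' μ hμ
    have h3 := h μ hμ _ hm
    have h4 := h μ hμ a ha
    have h5 := h μ hμ b hb
    simp only [Close, downTriangle, Finset.mem_insert, Finset.mem_singleton, Prod.ext_iff] at *
    omega
  · left
    intro μ hμ
    have h1 := ha' μ hμ
    have h2 := hb' μ hμ
    have h3 : ¬ (μ.1 = a.1 + 1 ∧ μ.2 = b.2 + 1) := fun h =>
      hm ((Prod.ext h.1 h.2 : μ = (a.1 + 1, b.2 + 1)) ▸ hμ)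
    have h4 := h μ hμ a ha
    have h5 := h μ hμ b hb
    simp only [Close, upTriangle, Finset.mem_insert, Finset.mem_singleton, Prod.ext_iff] at *
    omega

theorem upTriangle_mem (μ : Weight) : upTriangle μ ∈ coxeterComplex.faces := by
  refine ⟨by simp [upTriangle], 1, one_mem _, μ, ?_⟩
  intro ν
  simp [upTriangle, fundAlcove, fundWeight₁, fundWeight₂, Prod.ext_iff]

theorem downTriangle_mem (μ : Weight) : downTriangle μ ∈ coxeterComplex.faces := by
  -- the longest element of the Weyl group sends `λ₁`, `λ₂` to `-λ₂`, `-λ₁`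
  refine ⟨by simp [downTriangle], reflection₁ * reflection₂ * reflection₁,
    mul_mem (mul_mem reflection₁_mem reflection₂_mem) reflection₁_mem, (μ.1 + 1, μ.2 + 1), ?_⟩
  intro ν
  simp only [downTriangle, fundAlcove, fundWeight₁, fundWeight₂, Finset.mem_insert,
    Finset.mem_singleton, Finset.image_insert, Finset.image_singleton, Prod.ext_iff, reflection₁,
    reflection₂, LinearEquiv.mul_apply, LinearEquiv.coe_mk, LinearMap.coe_mk, AddHom.coe_mk,
    Prod.fst_add, Prod.snd_add, Prod.fst_zero, Prod.snd_zero]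
  omega

/-- The Coxeter complex is the flag complex of its graph. -/
theorem mem_coxeterComplex_iff {s : Finset Weight} :
    s ∈ coxeterComplex.faces ↔ s.Nonempty ∧ ∀ μ ∈ s, ∀ ν ∈ s, Close μ ν := by
  constructor
  · rintro ⟨hs, w, hw, κ, h⟩
    refine ⟨hs, fun μ hμ ν hν => ?_⟩
    obtain ⟨μ', hμ', rfl⟩ := Finset.mem_image.1 (h hμ)
    obtain ⟨ν', hν', rfl⟩ := Finset.mem_image.1 (h hν)
    have h1 : Close (w μ') (w ν') := by
      rw [close_weyl_iff hw]
      simp only [fundAlcove, fundWeight₁, fundWeight₂, Finset.mem_insert, Finset.mem_singleton,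
        Prod.ext_iff, Prod.fst_zero, Prod.snd_zero] at hμ' hν'
      simp only [Close]
      omega
    simp only [Close, Prod.fst_add, Prod.snd_add] at *
    omega
  · rintro ⟨hs, h⟩
    obtain ⟨μ, h | h⟩ := exists_subset_triangle hs h
    · exact (coxeterComplex.isRelLowerSet_faces (upTriangle_mem μ)).2 h hs
    · exact (coxeterComplex.isRelLowerSet_faces (downTriangle_mem μ)).2 h hs

theorem card_upTriangle (μ : Weight) : (upTriangle μ).card = 3 := by
  rw [upTriangle, Finset.card_eq_three]
  exact ⟨_, _, _, by simp [Prod.ext_iff], by simp [Prod.ext_iff], by simp, rfl⟩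

theorem card_downTriangle (μ : Weight) : (downTriangle μ).card = 3 := by
  rw [downTriangle, Finset.card_eq_three]
  exact ⟨_, _, _, by simp, by simp, by simp, rfl⟩

/-- Every simplex of the Coxeter complex lies in a chamber. -/
theorem exists_chamber_of_mem {s : Finset Weight} (hs : s ∈ coxeterComplex.faces) :
    ∃ t ∈ coxeterComplex.faces, t.card = 3 ∧ s ⊆ t := by
  obtain ⟨μ, h | h⟩ := exists_subset_triangle (mem_coxeterComplex_iff.1 hs).1
    (mem_coxeterComplex_iff.1 hs).2
  · exact ⟨_, upTriangle_mem μ, card_upTriangle μ, h⟩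
  · exact ⟨_, downTriangle_mem μ, card_downTriangle μ, h⟩

/-- Rigidity of the triangulated plane: an injective simplicial self-map that fixes a chamber is the
identity. An edge has exactly two common neighbours, so if a triangle is fixed then so are its
three neighbours. -/
theorem eq_self_of_fixes_chamber {θ : Weight → Weight} (hinj : Function.Injective θ)
    (hθ : ∀ μ ν, Close μ ν → Close (θ μ) (θ ν)) {t : Finset Weight}
    (ht : t ∈ coxeterComplex.faces) (hc : t.card = 3) (hfix : ∀ μ ∈ t, θ μ = μ) (μ : Weight) :
    θ μ = μ := by
  have third : ∀ u v w x : Weight, θ u = u → θ v = v → θ w = w →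
      (∀ y, Close y u → Close y v → y ≠ u → y ≠ v → y ≠ w → y = x) → Close x u → Close x v →
      x ≠ u → x ≠ v → x ≠ w → θ x = x := by
    intro u v w x hu hv hw hx xu xv nu nv nw
    have ne : ∀ y, θ y = y → x ≠ y → θ x ≠ y := fun y hy hxy h => hxy (hinj (h.trans hy.symm))
    apply hx
    · rw [← hu]; exact hθ _ _ xu
    · rw [← hv]; exact hθ _ _ xv
    exacts [ne u hu nu, ne v hv nv, ne w hw nw]
  have up_down : ∀ a b : ℤ, θ (a + 1, b) = (a + 1, b) → θ (a, b + 1) = (a, b + 1) →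
      (θ (a, b) = (a, b) ↔ θ (a + 1, b + 1) = (a + 1, b + 1)) := by
    intro a b h1 h2
    constructor <;> intro h3 <;> refine third _ _ _ _ h1 h2 h3 ?_ ?_ ?_ ?_ ?_ ?_ <;>
      simp only [Close, ne_eq, Prod.ext_iff] <;> omega
  let T : ℤ → ℤ → Prop := fun a b =>
    θ (a, b) = (a, b) ∧ θ (a + 1, b) = (a + 1, b) ∧ θ (a, b + 1) = (a, b + 1)
  have right : ∀ a b, T a b ↔ T (a + 1) b := by
    intro a b
    constructor
    · rintro ⟨h0, h1, h2⟩
      have h3 := (up_down a b h1 h2).1 h0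
      refine ⟨h1, ?_, h3⟩
      refine third _ _ _ _ h1 h3 h2 ?_ ?_ ?_ ?_ ?_ ?_ <;>
        simp only [Close, ne_eq, Prod.ext_iff] <;> omega
    · rintro ⟨h0, h1, h2⟩
      have h3 : θ (a, b + 1) = (a, b + 1) := by
        refine third _ _ _ _ h0 h2 h1 ?_ ?_ ?_ ?_ ?_ ?_ <;>
          simp only [Close, ne_eq, Prod.ext_iff] <;> omega
      exact ⟨(up_down a b h0 h3).2 h2, h0, h3⟩
  have above : ∀ a b, T a b ↔ T a (b + 1) := by
    intro a b
    constructor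
    · rintro ⟨h0, h1, h2⟩
      have h3 := (up_down a b h1 h2).1 h0
      refine ⟨h2, h3, ?_⟩
      refine third _ _ _ _ h2 h3 h1 ?_ ?_ ?_ ?_ ?_ ?_ <;>
        simp only [Close, ne_eq, Prod.ext_iff] <;> omega
    · rintro ⟨h0, h1, h2⟩
      have h3 : θ (a + 1, b) = (a + 1, b) := by
        refine third _ _ _ _ h0 h1 h2 ?_ ?_ ?_ ?_ ?_ ?_ <;>
          simp only [Close, ne_eq, Prod.ext_iff] <;> omega
      exact ⟨(up_down a b h3 h0).2 h1, h3, h0⟩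
  have all : ∀ a b, T a b → ∀ a' b', T a' b' := by
    intro a b h a' b'
    have h1 : T a' b := by
      induction a' using Int.inductionOn' (b := a) with
      | zero => exact h
      | succ k _ ih => exact (right k b).1 ih
      | pred k _ ih => exact (right (k - 1) b).2 (by simpa using ih)
    induction b' using Int.inductionOn' (b := b) with
    | zero => exact h1
    | succ k _ ih => exact (above a' k).1 ih
    | pred k _ ih => exact (above a' (k - 1)).2 (by simpa using ih)
  have hT : ∃ a b, T a b := by
    obtain ⟨ν, h | h⟩ := exists_subset_triangle (mem_coxeterComplex_iff.1 ht).1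
      (mem_coxeterComplex_iff.1 ht).2
    · obtain rfl := Finset.eq_of_subset_of_card_le h (by rw [hc, card_upTriangle])
      exact ⟨ν.1, ν.2, hfix _ (by simp [upTriangle]), hfix _ (by simp [upTriangle]),
        hfix _ (by simp [upTriangle])⟩
    · obtain rfl := Finset.eq_of_subset_of_card_le h (by rw [hc, card_downTriangle])
      have h1 := hfix (ν.1 + 1, ν.2) (by simp [downTriangle])
      have h2 := hfix (ν.1, ν.2 + 1) (by simp [downTriangle])
      exact ⟨ν.1, ν.2, (up_down _ _ h1 h2).2 (hfix _ (by simp [downTriangle])), h1, h2⟩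
  obtain ⟨a, b, h⟩ := hT
  exact (all a b h μ.1 μ.2).1

open scoped Classical

/-! ### Charts of apartments -/

theorem singleton_mem_of_mem {α : Type*} {K : PreAbstractSimplicialComplex α} {s : Finset α}
    (hs : s ∈ K.faces) {v : α} (hv : v ∈ s) : {v} ∈ K.faces :=
  (K.isRelLowerSet_faces hs).2 (Finset.singleton_subset_iff.2 hv) (Finset.singleton_nonempty v)

theorem mem_of_subset {α : Type*} {K : PreAbstractSimplicialComplex α} {s t : Finset α}
    (hs : s ∈ K.faces) (h : t ⊆ s) (ht : t.Nonempty) : t ∈ K.faces :=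
  (K.isRelLowerSet_faces hs).2 h ht

/-- The composition of two isomorphisms of simplicial complexes. -/
def SimplicialIso.trans {α β γ : Type*} {K : PreAbstractSimplicialComplex α}
    {L : PreAbstractSimplicialComplex β} {M : PreAbstractSimplicialComplex γ}
    (e : SimplicialIso K L) (e' : SimplicialIso L M) : SimplicialIso K M where
  toEquiv := e.toEquiv.trans e'.toEquiv
  map_faces s := by
    rw [e.map_faces, e'.map_faces]
    simp only [Finset.map_map]
    rfl

/-- The identity isomorphism of a simplicial complex. -/
def SimplicialIso.refl {α : Type*} (K : PreAbstractSimplicialComplex α) : SimplicialIso K K where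
  toEquiv := Equiv.refl _
  map_faces s := by simp

/-- A bijection of the weights that preserves closeness in both directions is an automorphism of the
Coxeter complex. -/
def coxeterIso (e : Weight ≃ Weight) (he : ∀ μ ν, Close (e μ) (e ν) ↔ Close μ ν) :
    SimplicialIso coxeterComplex.toPreAbstractSimplicialComplex
      coxeterComplex.toPreAbstractSimplicialComplex where
  toEquiv :=
    { toFun := fun v => ⟨e v.1, coxeterComplex.singleton_mem _⟩
      invFun := fun v => ⟨e.symm v.1, coxeterComplex.singleton_mem _⟩
      left_inv := fun v => by simp
      right_inv := fun v => by simp }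
  map_faces s := by
    rw [mem_coxeterComplex_iff, mem_coxeterComplex_iff, Finset.map_nonempty, Finset.map_nonempty,
      Finset.map_nonempty]
    refine and_congr_right fun _ => ?_
    simp only [Finset.forall_mem_map, Function.Embedding.coe_subtype, Equiv.coe_toEmbedding,
      Equiv.coe_fn_mk, he]

section Chart

variable {V : Type*} {A : PreAbstractSimplicialComplex V}
  (c : SimplicialIso A coxeterComplex.toPreAbstractSimplicialComplex)

/-- The weight that a chart attaches to a vertex of its apartment, extended by `0` to all vertices
of the building. -/
def SimplicialIso.coord (v : V) : Weight :=
  if h : {v} ∈ A.faces then (c.toEquiv ⟨v, h⟩ : Weight) else 0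

/-- The vertex of the apartment at a given weight. -/
def SimplicialIso.vertexAt (μ : Weight) : V :=
  (c.toEquiv.symm ⟨μ, coxeterComplex.singleton_mem μ⟩ : V)

theorem SimplicialIso.coord_eq {v : V} (h : {v} ∈ A.faces) :
    c.coord v = (c.toEquiv ⟨v, h⟩ : Weight) := dif_pos h

theorem SimplicialIso.vertexAt_mem (μ : Weight) : {c.vertexAt μ} ∈ A.faces :=
  (c.toEquiv.symm ⟨μ, coxeterComplex.singleton_mem μ⟩).2

theorem SimplicialIso.coord_vertexAt (μ : Weight) : c.coord (c.vertexAt μ) = μ := by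
  rw [c.coord_eq (c.vertexAt_mem μ)]
  simp [SimplicialIso.vertexAt]

theorem SimplicialIso.vertexAt_coord {v : V} (h : {v} ∈ A.faces) : c.vertexAt (c.coord v) = v := by
  simp [SimplicialIso.vertexAt, c.coord_eq h]

theorem SimplicialIso.coord_inj {u v : V} (hu : {u} ∈ A.faces) (hv : {v} ∈ A.faces)
    (h : c.coord u = c.coord v) : u = v := by
  rw [← c.vertexAt_coord hu, ← c.vertexAt_coord hv, h]

theorem SimplicialIso.mem_faces_iff {s : Finset V} (hs : ∀ v ∈ s, {v} ∈ A.faces) :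
    s ∈ A.faces ↔ s.Nonempty ∧ ∀ u ∈ s, ∀ v ∈ s, Close (c.coord u) (c.coord v) := by
  have h1 : ((s.subtype fun v => {v} ∈ A.faces).map (Function.Embedding.subtype _)) = s := by
    rw [Finset.subtype_map, Finset.filter_true_of_mem hs]
  have h2 := c.map_faces (s.subtype fun v => {v} ∈ A.faces)
  rw [h1] at h2
  rw [h2]
  change _ ∈ coxeterComplex.faces ↔ _
  rw [mem_coxeterComplex_iff, Finset.map_nonempty, Finset.map_nonempty]
  refine and_congr ?_ ?_
  · rw [← Finset.map_nonempty (f := Function.Embedding.subtype _), h1]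
  · simp only [Finset.forall_mem_map, Finset.mem_subtype, Function.Embedding.coe_subtype,
      Equiv.coe_toEmbedding, Subtype.forall]
    constructor
    · intro h u hu v hv
      rw [c.coord_eq (hs u hu), c.coord_eq (hs v hv)]
      exact h u (hs u hu) hu v (hs v hv) hv
    · intro h u hu' hu v hv' hv
      rw [← c.coord_eq, ← c.coord_eq]
      exact h u hu v hv

theorem SimplicialIso.pair_mem_iff {u v : V} (hu : {u} ∈ A.faces) (hv : {v} ∈ A.faces) :
    {u, v} ∈ A.faces ↔ Close (c.coord u) (c.coord v) := by
  rw [c.mem_faces_iff (by simp [hu, hv])]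
  constructor
  · intro h
    exact h.2 u (by simp) v (by simp)
  · intro h
    refine ⟨by simp, ?_⟩
    simp [h, h.symm, Close.refl]

theorem SimplicialIso.image_vertexAt_mem {t : Finset Weight} (ht : t ∈ coxeterComplex.faces) :
    t.image c.vertexAt ∈ A.faces := by
  rw [c.mem_faces_iff]
  · rw [mem_coxeterComplex_iff] at ht
    refine ⟨ht.1.image _, ?_⟩
    simp only [Finset.forall_mem_image, c.coord_vertexAt]
    exact fun u hu v hv => ht.2 u hu v hv
  · simp only [Finset.forall_mem_image]
    exact fun u _ => c.vertexAt_mem u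

theorem SimplicialIso.vertexAt_injective : Function.Injective c.vertexAt := fun μ ν h => by
  rw [← c.coord_vertexAt μ, h, c.coord_vertexAt]

theorem SimplicialIso.exists_chamber
    (c : SimplicialIso A coxeterComplex.toPreAbstractSimplicialComplex) {s : Finset V}
    (hs : s ∈ A.faces) :
    ∃ D ∈ A.faces, D.card = 3 ∧ s ⊆ D := by
  have hv : ∀ v ∈ s, {v} ∈ A.faces := fun v => singleton_mem_of_mem hs
  have h1 : s.image c.coord ∈ coxeterComplex.faces := by
    rw [mem_coxeterComplex_iff]
    have := (c.mem_faces_iff hv).1 hs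
    refine ⟨this.1.image _, ?_⟩
    simpa only [Finset.forall_mem_image] using this.2
  obtain ⟨t, ht, h3, hst⟩ := exists_chamber_of_mem h1
  refine ⟨t.image c.vertexAt, c.image_vertexAt_mem ht, ?_, ?_⟩
  · rw [Finset.card_image_of_injective _ c.vertexAt_injective, h3]
  · intro v hvs
    rw [← c.vertexAt_coord (hv v hvs)]
    exact Finset.mem_image_of_mem _ (hst (Finset.mem_image_of_mem _ hvs))

/-- A chart of an apartment is determined by its values on a chamber. -/
theorem SimplicialIso.coord_eq_of_eqOn_chamber
    (c' : SimplicialIso A coxeterComplex.toPreAbstractSimplicialComplex) {D : Finset V}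
    (hD : D ∈ A.faces) (h3 : D.card = 3) (h : ∀ v ∈ D, c.coord v = c'.coord v) {v : V}
    (hv : {v} ∈ A.faces) : c.coord v = c'.coord v := by
  have hDv : ∀ v ∈ D, {v} ∈ A.faces := fun v => singleton_mem_of_mem hD
  have key := eq_self_of_fixes_chamber (θ := fun μ => c'.coord (c.vertexAt μ))
    (t := D.image c.coord) ?_ ?_ ?_ ?_ ?_ (c.coord v)
  · simp only [c.vertexAt_coord hv] at key
    exact key.symm
  · intro μ ν hμν
    exact c.vertexAt_injective (c'.coord_inj (c.vertexAt_mem _) (c.vertexAt_mem _) hμν)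
  · intro μ ν hμν
    rw [← c'.pair_mem_iff (c.vertexAt_mem _) (c.vertexAt_mem _),
      c.pair_mem_iff (c.vertexAt_mem _) (c.vertexAt_mem _), c.coord_vertexAt, c.coord_vertexAt]
    exact hμν
  · rw [mem_coxeterComplex_iff]
    have := (c.mem_faces_iff hDv).1 hD
    refine ⟨this.1.image _, ?_⟩
    simpa only [Finset.forall_mem_image] using this.2
  · rw [Finset.card_image_of_injOn, h3]
    exact fun u hu v hv huv => c.coord_inj (hDv u hu) (hDv v hv) huv
  · simp only [Finset.forall_mem_image]
    intro u hu
    rw [c.vertexAt_coord (hDv u hu), h u hu]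

theorem SimplicialIso.coord_trans {A' : PreAbstractSimplicialComplex V} (φ : SimplicialIso A' A)
    {v : V} (hv : {v} ∈ A'.faces) : (φ.trans c).coord v = c.coord (φ.toEquiv ⟨v, hv⟩) := by
  rw [SimplicialIso.coord_eq _ hv, SimplicialIso.coord_eq _ (φ.toEquiv ⟨v, hv⟩).2]
  rfl

theorem SimplicialIso.coord_trans_coxeterIso (e : Weight ≃ Weight)
    (he : ∀ μ ν, Close (e μ) (e ν) ↔ Close μ ν) {v : V} (hv : {v} ∈ A.faces) :
    (c.trans (coxeterIso e he)).coord v = e (c.coord v) := by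
  rw [SimplicialIso.coord_eq _ hv, SimplicialIso.coord_eq _ hv]
  rfl

end Chart

/-! ### Retractions onto an apartment -/

namespace Building

variable {V : Type*} (B : Building V)

theorem exists_isChamber {s : Finset V} (hs : s ∈ B.complex.faces) :
    ∃ D, B.IsChamber D ∧ s ⊆ D := by
  obtain ⟨A, hA, hsA⟩ := B.exists_apartment s hs
  obtain ⟨c⟩ := B.apartment_iso A hA
  obtain ⟨D, hD, h3, hsD⟩ := c.exists_chamber hsA
  exact ⟨D, ⟨B.apartment_le A hA hD, h3⟩, hsD⟩

theorem exists_apartment_chamber_simplex {D s : Finset V} (hD : B.IsChamber D)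
    (hs : s ∈ B.complex.faces) : ∃ A ∈ B.apartments, D ∈ A.faces ∧ s ∈ A.faces := by
  obtain ⟨E, hE, hsE⟩ := B.exists_isChamber hs
  obtain ⟨A, hA, hDA, hEA⟩ := B.exists_common_apartment D hD.1 hD.2 E hE.1 hE.2
  exact ⟨A, hA, hDA, mem_of_subset hEA hsE (B.complex.isRelLowerSet_faces hs).1⟩

/-- `ρ` is, in the coordinates of a chart, a retraction of the building centred at `D`: it restricts
to a chart on every apartment that contains `D`. -/
def IsRetraction (D : Finset V) (ρ : V → Weight) : Prop :=
  ∀ A ∈ B.apartments, D ∈ A.faces →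
    ∃ c : SimplicialIso A coxeterComplex.toPreAbstractSimplicialComplex,
      ∀ v, {v} ∈ A.faces → c.coord v = ρ v

variable {B}

/-- A chart of an apartment extends to a retraction centred at any of its chambers. The isomorphisms
between the apartments that contain the chamber are compatible by rigidity. -/
theorem exists_isRetraction {A : PreAbstractSimplicialComplex V} (hA : A ∈ B.apartments)
    (c : SimplicialIso A coxeterComplex.toPreAbstractSimplicialComplex) {D : Finset V}
    (hD : D ∈ A.faces) (h3 : D.card = 3) :
    ∃ ρ, B.IsRetraction D ρ ∧ ∀ v, {v} ∈ A.faces → ρ v = c.coord v := by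
  have hDc : B.IsChamber D := ⟨B.apartment_le A hA hD, h3⟩
  have iso : ∀ A₁ ∈ B.apartments, ∀ A₂ ∈ B.apartments, D ∈ A₁.faces → D ∈ A₂.faces →
      ∃ φ : SimplicialIso A₁ A₂, ∀ v : Vertex A₁, {v.1} ∈ A₂.faces → (φ.toEquiv v : V) = v :=
    fun A₁ h₁ A₂ h₂ hD₁ hD₂ => (B.exists_unique_iso A₁ h₁ A₂ h₂ ⟨D, h3, hD₁, hD₂⟩).exists
  have chart : ∀ A' : PreAbstractSimplicialComplex V, A' ∈ B.apartments → D ∈ A'.faces →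
      ∃ c' : SimplicialIso A' coxeterComplex.toPreAbstractSimplicialComplex,
        ∀ v, {v} ∈ A.faces → {v} ∈ A'.faces → c'.coord v = c.coord v := by
    intro A' hA' hD'
    obtain ⟨φ, hφ⟩ := iso A' hA' A hA hD' hD
    refine ⟨φ.trans c, fun v hv hv' => ?_⟩
    rw [c.coord_trans φ hv', hφ ⟨v, hv'⟩ hv]
  choose ch hch using chart
  have compat : ∀ A₁ (h₁ : A₁ ∈ B.apartments) A₂ (h₂ : A₂ ∈ B.apartments) (hD₁ : D ∈ A₁.faces)
      (hD₂ : D ∈ A₂.faces) (v : V), {v} ∈ A₁.faces → {v} ∈ A₂.faces →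
        (ch A₁ h₁ hD₁).coord v = (ch A₂ h₂ hD₂).coord v := by
    intro A₁ h₁ A₂ h₂ hD₁ hD₂ v hv₁ hv₂
    obtain ⟨ψ, hψ⟩ := iso A₁ h₁ A₂ h₂ hD₁ hD₂
    have hfix : ∀ u (hu₁ : {u} ∈ A₁.faces), {u} ∈ A₂.faces →
        (ψ.trans (ch A₂ h₂ hD₂)).coord u = (ch A₂ h₂ hD₂).coord u := by
      intro u hu₁ hu₂
      rw [SimplicialIso.coord_trans _ ψ hu₁, hψ ⟨u, hu₁⟩ hu₂]
    rw [← hfix v hv₁ hv₂]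
    refine SimplicialIso.coord_eq_of_eqOn_chamber _ _ hD₁ h3 (fun u hu => ?_) hv₁
    have hu := singleton_mem_of_mem hD hu
    have hu₁ := singleton_mem_of_mem hD₁ ‹u ∈ D›
    have hu₂ := singleton_mem_of_mem hD₂ ‹u ∈ D›
    rw [hfix u hu₁ hu₂, hch A₁ h₁ hD₁ u hu hu₁, hch A₂ h₂ hD₂ u hu hu₂]
  have apt : ∀ v : V, ∃ A' ∈ B.apartments, D ∈ A'.faces ∧ {v} ∈ A'.faces := fun v =>
    B.exists_apartment_chamber_simplex hDc (B.complex.singleton_mem v)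
  choose Av hAv hDv hv using apt
  refine ⟨fun v => (ch (Av v) (hAv v) (hDv v)).coord v, fun A' hA' hD' =>
    ⟨ch A' hA' hD', fun v hv' => compat _ _ _ _ _ _ v hv' (hv v)⟩, fun v hvA => ?_⟩
  exact hch _ _ _ v hvA (hv v)

variable (B) in
/-- Adjacency of vertices in the building. -/
def Adj (x y : V) : Prop := x ≠ y ∧ {x, y} ∈ B.complex.faces

theorem Adj.symm {x y : V} (h : B.Adj x y) : B.Adj y x :=
  ⟨h.1.symm, by rw [Finset.pair_comm]; exact h.2⟩

/-- Retractions are simplicial and do not collapse edges. -/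
theorem IsRetraction.close {D : Finset V} {ρ : V → Weight} (hρ : B.IsRetraction D ρ)
    (hD : B.IsChamber D) {x y : V} (h : B.Adj x y) : Close (ρ x) (ρ y) ∧ ρ x ≠ ρ y := by
  obtain ⟨A, hA, hDA, hxy⟩ := B.exists_apartment_chamber_simplex hD h.2
  obtain ⟨c, hc⟩ := hρ A hA hDA
  have hx : {x} ∈ A.faces := singleton_mem_of_mem hxy (by simp)
  have hy : {y} ∈ A.faces := singleton_mem_of_mem hxy (by simp)
  rw [← hc x hx, ← hc y hy]
  exact ⟨(c.pair_mem_iff hx hy).1 hxy, fun hn => h.1 (c.coord_inj hx hy hn)⟩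

/-- Over the centre a retraction is injective: an apartment contains the centre together with any
given vertex. -/
theorem IsRetraction.eq_of_mem {D : Finset V} {ρ : V → Weight} (hρ : B.IsRetraction D ρ)
    (hD : B.IsChamber D) {u v : V} (hu : u ∈ D) (h : ρ v = ρ u) : v = u := by
  obtain ⟨A, hA, hDA, hv⟩ := B.exists_apartment_chamber_simplex hD (B.complex.singleton_mem v)
  obtain ⟨c, hc⟩ := hρ A hA hDA
  have hu := singleton_mem_of_mem hDA hu
  exact c.coord_inj hv hu (by rw [hc v hv, hc u hu, h])

/-- The retraction onto the apartment of a frame, centred at its chamber, computes radial parts. -/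
theorem Frame.exists_isRetraction {o : V} (f : B.Frame o) :
    ∃ r : V → Weight, B.IsRetraction f.chamber r ∧ B.IsChamber f.chamber ∧ o ∈ f.chamber ∧
      r o = 0 ∧ ∀ x μ, f.IsRadialPart x μ → μ = dom (r x) := by
  have hv : ∀ v ∈ f.chamber, {v} ∈ f.apartment.faces := fun v => singleton_mem_of_mem f.chamber_mem
  have himg : f.chamber = fundAlcove.image f.chart.vertexAt := by
    ext v
    rw [Finset.mem_image]
    constructor
    · intro h
      exact ⟨f.chart.coord v, by
        rw [f.chart.coord_eq (hv v h)]; exact (f.mem_chamber_iff ⟨v, hv v h⟩).1 h,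
        f.chart.vertexAt_coord (hv v h)⟩
    · rintro ⟨μ, hμ, rfl⟩
      refine (f.mem_chamber_iff ⟨_, f.chart.vertexAt_mem μ⟩).2 ?_
      rw [← f.chart.coord_eq, f.chart.coord_vertexAt]
      exact hμ
  have h3 : f.chamber.card = 3 := by
    rw [himg, Finset.card_image_of_injective _ f.chart.vertexAt_injective]
    rfl
  obtain ⟨r, hr, hrc⟩ := B.exists_isRetraction f.apartment_mem f.chart f.chamber_mem h3
  refine ⟨r, hr, ⟨B.apartment_le _ f.apartment_mem f.chamber_mem, h3⟩, ?_, ?_, ?_⟩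
  · rw [f.mem_chamber_iff ⟨o, f.origin_mem⟩, f.chart_origin]
    simp [fundAlcove]
  · rw [hrc o f.origin_mem, f.chart.coord_eq f.origin_mem, f.chart_origin]
  · rintro x μ ⟨h₁, h₂, A, hA, hCA, hx, φ, hφ, w, hw, rfl⟩
    obtain ⟨c, hc⟩ := hr A hA hCA
    rw [← f.chart.coord_eq (φ.toEquiv ⟨x, hx⟩).2] at h₁ h₂ ⊢
    rw [← f.chart.coord_trans φ hx] at h₁ h₂ ⊢
    rw [← dom_of_nonneg h₁ h₂, dom_weyl hw, ← hc x hx]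
    congr 1
    refine SimplicialIso.coord_eq_of_eqOn_chamber _ _ hCA h3 (fun u hu => ?_) hx
    have huA := singleton_mem_of_mem hCA hu
    rw [f.chart.coord_trans φ huA, hφ ⟨u, huA⟩ hu, hc u huA, hrc u (hv u hu)]

end Building

/-! ### Neighbours and radial parts -/

/-- The norm `x₁ + x₂` of the dominant representative `x₁ λ₁ + x₂ λ₂` of a weight. -/
def height (μ : Weight) : ℤ := (dom μ).1 + (dom μ).2

theorem height_nonneg (μ : Weight) : 0 ≤ height μ := add_nonneg (dom_nonneg μ).1 (dom_nonneg μ).2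

theorem height_dom (μ : Weight) : height (dom μ) = height μ := by
  rw [height, dom_of_nonneg (dom_nonneg μ).1 (dom_nonneg μ).2, height]

theorem Close.height_le {μ ν : Weight} (h : Close μ ν) : height μ ≤ height ν + 1 := by
  have := h.dom
  simp only [Close, height] at *
  omega

/-- Adjacent weights are not conjugate: they differ in `P` modulo the root lattice. -/
theorem dom_ne_dom {μ ν : Weight} (h : Close μ ν) (hne : μ ≠ ν) : dom μ ≠ dom ν := by
  intro he
  have h1 := congrArg Prod.fst he
  have h2 := congrArg Prod.snd he
  simp only [Close, dom, ne_eq, Prod.ext_iff] at *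
  omega

theorem exists_step_down {μ : Weight} (h₁ : 0 ≤ μ.1) (h₂ : 0 ≤ μ.2) (h : 1 ≤ height μ) :
    ∃ ν : Weight, 0 ≤ ν.1 ∧ 0 ≤ ν.2 ∧ Close ν μ ∧ ν ≠ μ ∧ height ν = height μ - 1 := by
  have key : ∀ ν : Weight, 0 ≤ ν.1 → 0 ≤ ν.2 → height ν = ν.1 + ν.2 := fun ν h₁ h₂ => by
    rw [height, dom_of_nonneg h₁ h₂]
  rw [key μ h₁ h₂] at h ⊢
  by_cases h0 : μ.1 = 0
  · refine ⟨(μ.1, μ.2 - 1), h₁, by simp only; omega, ?_, ?_, ?_⟩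
    · simp only [Close]; omega
    · simp only [ne_eq, Prod.ext_iff]; omega
    · exact (key (μ.1, μ.2 - 1) h₁ (by simp only; omega)).trans (by simp only; omega)
  · refine ⟨(μ.1 - 1, μ.2), by simp only; omega, h₂, ?_, ?_, ?_⟩
    · simp only [Close]; omega
    · simp only [ne_eq, Prod.ext_iff]; omega
    · exact (key (μ.1 - 1, μ.2) (by simp only; omega) h₂).trans (by simp only; omega)

/-- The neighbours of a dominant weight that are closer to the origin lie in a common chamber. -/
theorem mem_downTriangle_of_height_lt {μ ν : Weight} (h₁ : 0 ≤ μ.1) (h₂ : 0 ≤ μ.2) (h : Close ν μ)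
    (hlt : height ν < height μ) : ν ∈ downTriangle (μ.1 - 1, μ.2 - 1) := by
  simp only [height, Close, downTriangle, Finset.mem_insert, Finset.mem_singleton, dom,
    Prod.ext_iff] at *
  omega

/-- The vertices of a chamber are pairwise not conjugate. -/
theorem eq_of_mem_downTriangle {μ ν ν' : Weight} (hν : ν ∈ downTriangle μ)
    (hν' : ν' ∈ downTriangle μ) (hd : dom ν = dom ν') : ν = ν' := by
  have e1 := congrArg Prod.fst hd
  have e2 := congrArg Prod.snd hd
  simp only [downTriangle, Finset.mem_insert, Finset.mem_singleton, dom, Prod.ext_iff] at *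
  omega

/-- Around a vertex of the triangulated plane the neighbours form a hexagon, of diameter three. -/
theorem exists_hexagon_path {μ α β : Weight} (hα : Close α μ) (hαne : α ≠ μ) (hβ : Close β μ)
    (hβne : β ≠ μ) : ∃ γ δ : Weight, (Close γ μ ∧ γ ≠ μ) ∧ (Close δ μ ∧ δ ≠ μ) ∧
      Close α γ ∧ Close γ δ ∧ Close δ β := by
  have hex : ∀ a ∈ ({(1, 0), (0, 1), (-1, 1), (-1, 0), (0, -1), (1, -1)} : Finset Weight),
      ∀ b ∈ ({(1, 0), (0, 1), (-1, 1), (-1, 0), (0, -1), (1, -1)} : Finset Weight),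
      ∃ c ∈ ({(1, 0), (0, 1), (-1, 1), (-1, 0), (0, -1), (1, -1)} : Finset Weight),
      ∃ d ∈ ({(1, 0), (0, 1), (-1, 1), (-1, 0), (0, -1), (1, -1)} : Finset Weight),
      Close a c ∧ Close c d ∧ Close d b := by
    unfold Close
    decide
  have mem : ∀ ν, Close ν μ → ν ≠ μ →
      ν - μ ∈ ({(1, 0), (0, 1), (-1, 1), (-1, 0), (0, -1), (1, -1)} : Finset Weight) := by
    intro ν h hne
    simp only [Close, ne_eq, Prod.ext_iff, Finset.mem_insert, Finset.mem_singleton, Prod.fst_sub,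
      Prod.snd_sub] at *
    omega
  have mem' : ∀ ν ∈ ({(1, 0), (0, 1), (-1, 1), (-1, 0), (0, -1), (1, -1)} : Finset Weight),
      Close (μ + ν) μ ∧ μ + ν ≠ μ := by
    intro ν h
    simp only [Close, ne_eq, Prod.ext_iff, Finset.mem_insert, Finset.mem_singleton, Prod.fst_add,
      Prod.snd_add] at *
    omega
  obtain ⟨c, hc, d, hd, h1, h2, h3⟩ := hex _ (mem α hα hαne) _ (mem β hβ hβne)
  refine ⟨μ + c, μ + d, mem' c hc, mem' d hd, ?_⟩
  simp only [Close, Prod.fst_add, Prod.snd_add, Prod.fst_sub, Prod.snd_sub] at *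
  omega

/-- Conjugation of a chart by an element of the Weyl group. -/
theorem exists_coord_weyl {V : Type*} {A : PreAbstractSimplicialComplex V}
    (c : SimplicialIso A coxeterComplex.toPreAbstractSimplicialComplex)
    {w : Weight ≃ₗ[ℤ] Weight} (hw : w ∈ weylGroup) :
    ∃ c' : SimplicialIso A coxeterComplex.toPreAbstractSimplicialComplex,
      ∀ v, {v} ∈ A.faces → c'.coord v = w (c.coord v) :=
  ⟨c.trans (coxeterIso w.toEquiv (close_weyl_iff hw)), fun _ hv =>
    c.coord_trans_coxeterIso _ _ hv⟩

/-- Translation of a chart. -/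
theorem exists_coord_sub {V : Type*} {A : PreAbstractSimplicialComplex V}
    (c : SimplicialIso A coxeterComplex.toPreAbstractSimplicialComplex) (κ : Weight) :
    ∃ c' : SimplicialIso A coxeterComplex.toPreAbstractSimplicialComplex,
      ∀ v, {v} ∈ A.faces → c'.coord v = c.coord v - κ := by
  refine ⟨c.trans (coxeterIso (Equiv.subRight κ) fun μ ν => ?_), fun _ hv =>
    c.coord_trans_coxeterIso _ _ hv⟩
  simp only [Close, Equiv.subRight_apply, Prod.fst_sub, Prod.snd_sub]
  omega

namespace Building

variable {V : Type*} {B : Building V} {D : Finset V} {r : V → Weight}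

/-- Every vertex `x` lies, together with the centre of a retraction, in an apartment; it has a chart
in which `x` is dominant and which computes the radial parts of all vertices. -/
theorem IsRetraction.exists_dominant_chart (hr : B.IsRetraction D r) (hD : B.IsChamber D) (x : V) :
    ∃ A ∈ B.apartments, D ∈ A.faces ∧ {x} ∈ A.faces ∧
      ∃ c : SimplicialIso A coxeterComplex.toPreAbstractSimplicialComplex,
        c.coord x = dom (r x) ∧ ∀ v, {v} ∈ A.faces → dom (c.coord v) = dom (r v) := by
  obtain ⟨A, hA, hDA, hx⟩ := B.exists_apartment_chamber_simplex hD (B.complex.singleton_mem x)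
  obtain ⟨c, hc⟩ := hr A hA hDA
  obtain ⟨w, hw, hwx⟩ := exists_weyl_dom (r x)
  obtain ⟨c', hc'⟩ := exists_coord_weyl c hw
  refine ⟨A, hA, hDA, hx, c', ?_, fun v hv => ?_⟩
  · rw [hc' x hx, hc x hx, hwx]
  · rw [hc' v hv, hc v hv, dom_weyl hw]

/-- Every dominant neighbour of the radial part of `x` is the radial part of a neighbour of `x`. -/
theorem IsRetraction.exists_adj (hr : B.IsRetraction D r) (hD : B.IsChamber D) (x : V) {ν : Weight}
    (h₁ : 0 ≤ ν.1) (h₂ : 0 ≤ ν.2) (hν : Close ν (dom (r x))) (hne : ν ≠ dom (r x)) :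
    ∃ y, B.Adj y x ∧ dom (r y) = ν := by
  obtain ⟨A, hA, hDA, hx, c, hcx, hc⟩ := hr.exists_dominant_chart hD x
  have hy := c.vertexAt_mem ν
  refine ⟨c.vertexAt ν, ⟨?_, B.apartment_le A hA ?_⟩, ?_⟩
  · intro h
    apply hne
    rw [← hcx, ← h, c.coord_vertexAt]
  · rw [c.pair_mem_iff hy hx, c.coord_vertexAt, hcx]
    exact hν
  · rw [← hc _ hy, c.coord_vertexAt, dom_of_nonneg h₁ h₂]

/-- The norm of the radial part of `v` is its distance from the origin. Hence a simplicial map to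
the plane that fixes the origin cannot increase the norm. -/
theorem height_le_of_simplicial (hr : B.IsRetraction D r) (hD : B.IsChamber D) {o : V}
    (ho : o ∈ D) (hro : r o = 0) {s : V → Weight}
    (hs : ∀ x y, B.Adj x y → Close (s x) (s y)) (hso : s o = 0) (v : V) :
    height (s v) ≤ height (r v) := by
  obtain ⟨k, hk⟩ : ∃ k : ℕ, height (r v) = k := ⟨_, (Int.toNat_of_nonneg (height_nonneg _)).symm⟩
  induction k generalizing v with
  | zero =>
    have h0 : dom (r v) = 0 := by
      have := dom_nonneg (r v)
      simp only [height] at hk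
      ext <;> simp only [Prod.fst_zero, Prod.snd_zero] <;> omega
    have : v = o := hr.eq_of_mem hD ho (by rw [dom_eq_zero h0, hro])
    rw [this, hro, hso]
  | succ k ih =>
    obtain ⟨ν, h₁, h₂, hc, hne, hh⟩ := exists_step_down (dom_nonneg (r v)).1 (dom_nonneg (r v)).2
      (by rw [height_dom, hk]; omega)
    obtain ⟨y, hy, hyν⟩ := hr.exists_adj hD v h₁ h₂ hc hne
    have hyk : height (r y) = k := by
      rw [← height_dom, hyν, hh, height_dom, hk]; omega
    have := ih y hyk
    have := (hs v y hy.symm).height_le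
    omega

/-- A neighbour of `x` that is closer to the origin than `x` is determined by its radial part.

Take an apartment that contains the origin and `x`, and in it the chamber at `x` that contains all
the neighbours of `x` nearer to the origin. The retraction centred at this chamber does not increase the
distance from the origin, so it sends every nearer neighbour into the chamber; and over its centre
it is injective. -/
theorem IsRetraction.eq_of_height_lt (hr : B.IsRetraction D r) (hD : B.IsChamber D) {o : V}
    (ho : o ∈ D) (hro : r o = 0) {x y y' : V} (hy : B.Adj y x) (hy' : B.Adj y' x)
    (hd : dom (r y) = dom (r y')) (hlt : height (r y) < height (r x)) : y = y' := by
  obtain ⟨A, hA, hDA, hx, c, hcx, hc⟩ := hr.exists_dominant_chart hD x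
  obtain ⟨h₁, h₂⟩ := dom_nonneg (r x)
  set t := downTriangle ((dom (r x)).1 - 1, (dom (r x)).2 - 1) with ht
  have htmem : t ∈ coxeterComplex.faces := downTriangle_mem _
  set E := t.image c.vertexAt with hE
  have hEA : E ∈ A.faces := c.image_vertexAt_mem htmem
  have hE3 : E.card = 3 := by
    rw [hE, Finset.card_image_of_injective _ c.vertexAt_injective, ht, card_downTriangle]
  have hEc : B.IsChamber E := ⟨B.apartment_le A hA hEA, hE3⟩
  obtain ⟨s, hs, hsc⟩ := B.exists_isRetraction hA c hEA hE3
  have hoA := singleton_mem_of_mem hDA ho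
  have hso : s o = 0 := by
    rw [hsc o hoA]
    apply dom_eq_zero
    rw [hc o hoA, hro]
    exact dom_of_nonneg le_rfl le_rfl
  have near : ∀ z, B.Adj z x → height (r z) < height (r x) →
      c.coord z ∈ t ∧ {z} ∈ A.faces := by
    intro z hz hlt
    have h1 : s z ∈ t := by
      apply mem_downTriangle_of_height_lt h₁ h₂
      · rw [← hcx, ← hsc x hx]
        exact (hs.close hEc hz).1
      · rw [height_dom]
        exact (height_le_of_simplicial hr hD ho hro (fun x y h => (hs.close hEc h).1) hso z).trans_lt
          hlt
    have hz : z = c.vertexAt (s z) := by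
      apply hs.eq_of_mem hEc (Finset.mem_image_of_mem _ h1)
      rw [hsc _ (c.vertexAt_mem _), c.coord_vertexAt]
    have hzA : {z} ∈ A.faces := by rw [hz]; exact c.vertexAt_mem _
    refine ⟨?_, hzA⟩
    rw [← hsc z hzA]
    exact h1
  have hlt' : height (r y') < height (r x) := by rwa [← height_dom, ← hd, height_dom]
  obtain ⟨m, hyA⟩ := near y hy hlt
  obtain ⟨m', hyA'⟩ := near y' hy' hlt'
  refine c.coord_inj hyA hyA' (eq_of_mem_downTriangle m m' ?_)
  rw [hc y hyA, hc y' hyA', hd]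

/-- The third vertices of the chambers that contain a given edge are at most `q + 1` in number. -/
theorem encard_third_vertex_le {q : ℕ} (hq : B.IsRegular q) (x u : V) :
    {y | x ≠ u ∧ B.IsChamber {x, u, y}}.encard ≤ q + 1 := by
  rcases Set.eq_empty_or_nonempty {y | x ≠ u ∧ B.IsChamber {x, u, y}} with h | ⟨y₀, hxu, hy₀⟩
  · simp [h]
  · have h2 := hq _ hy₀ {x, u} (by intro z; simp; tauto) (Finset.card_pair hxu)
    have hinj : Set.InjOn (fun y => ({x, u, y} : Finset V))
        {y | x ≠ u ∧ B.IsChamber {x, u, y}} := by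
      rintro y ⟨-, hy⟩ y' ⟨-, hy'⟩ h
      have hmem : y ∈ ({x, u, y'} : Finset V) := by
        rw [← show ({x, u, y} : Finset V) = {x, u, y'} from h]; simp
      simp only [Finset.mem_insert, Finset.mem_singleton] at hmem
      rcases hmem with rfl | rfl | h
      · have h3 : ({y, u, y} : Finset V).card = 3 := hy.2
        have : ({y, u, y} : Finset V) = {y, u} := by ext; simp; tauto
        rw [this] at h3
        have := Finset.card_le_two (a := y) (b := u)
        omega
      · have h3 : ({x, y, y} : Finset V).card = 3 := hy.2
        have : ({x, y, y} : Finset V) = {x, y} := by ext; simp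
        rw [this] at h3
        have := Finset.card_le_two (a := x) (b := y)
        omega
      · exact h
    rw [← hinj.encard_image, ← h2]
    refine (Set.encard_le_encard (t := insert {x, u, y₀} _) ?_).trans (Set.encard_insert_le _ _)
    rintro _ ⟨y, ⟨-, hy⟩, rfl⟩
    by_cases he : ({x, u, y} : Finset V) = {x, u, y₀}
    · exact Or.inl he
    · exact Or.inr ⟨hy, he, by intro z; simp; tauto⟩

/-- A vertex has at most `(q + 2)³` neighbours: two of them are joined in its link by a path of
length at most three, and every step of such a path has at most `q + 2` choices. -/
theorem exists_neighborFinset {q : ℕ} (hq : B.IsRegular q) (x : V) :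
    ∃ N : Finset V, (∀ y, y ∈ N ↔ B.Adj y x) ∧ N.card ≤ (q + 2) ^ 3 := by
  have step : ∀ u : V, ∃ S : Finset V, S.card ≤ q + 2 ∧ u ∈ S ∧
      ∀ y, x ≠ u → B.IsChamber {x, u, y} → y ∈ S := by
    intro u
    have h := encard_third_vertex_le hq x u
    have hfin : {y | x ≠ u ∧ B.IsChamber {x, u, y}}.Finite :=
      Set.finite_of_encard_le_coe (k := q + 1) (by exact_mod_cast h)
    refine ⟨insert u hfin.toFinset, ?_, by simp, fun y h1 h2 => by simp [h1, h2]⟩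
    rw [hfin.encard_eq_coe_toFinset_card] at h
    have h' : hfin.toFinset.card ≤ q + 1 := by exact_mod_cast h
    exact (Finset.card_insert_le _ _).trans (by omega)
  choose S hScard hSself hS using step
  by_cases hne : ∃ a, B.Adj a x
  · obtain ⟨a, ha⟩ := hne
    let N := (((S a).biUnion S).biUnion S)
    have hcard : N.card ≤ (q + 2) ^ 3 := by
      refine (Finset.card_biUnion_le_card_mul _ _ _ fun u _ => hScard u).trans ?_
      have := (Finset.card_biUnion_le_card_mul (S a) S _ fun u _ => hScard u).trans
        (Nat.mul_le_mul_right _ (hScard a))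
      calc _ ≤ (q + 2) * (q + 2) * (q + 2) := Nat.mul_le_mul_right _ this
        _ = _ := by ring
    have hsub : ∀ y, B.Adj y x → y ∈ N := by
      intro y hy
      obtain ⟨E, hE, haE⟩ := B.exists_isChamber ha.2
      obtain ⟨A, hA, hEA, hyx⟩ := B.exists_apartment_chamber_simplex hE hy.2
      obtain ⟨c⟩ := B.apartment_iso A hA
      have hxA : {x} ∈ A.faces := singleton_mem_of_mem hEA (haE (by simp))
      have haA : {a} ∈ A.faces := singleton_mem_of_mem hEA (haE (by simp))
      have hyA : {y} ∈ A.faces := singleton_mem_of_mem hyx (by simp)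
      obtain ⟨γ, δ, ⟨hγ, hγne⟩, ⟨hδ, hδne⟩, h1, h2, h3⟩ := exists_hexagon_path
        ((c.pair_mem_iff haA hxA).1 (mem_of_subset hEA haE (by simp)))
        (fun h => ha.1 (c.coord_inj haA hxA h)) ((c.pair_mem_iff hyA hxA).1 hyx)
        (fun h => hy.1 (c.coord_inj hyA hxA h))
      have link : ∀ u v, {u} ∈ A.faces → {v} ∈ A.faces → u ≠ x → v ≠ x →
          Close (c.coord u) (c.coord x) → Close (c.coord v) (c.coord x) →
          Close (c.coord u) (c.coord v) → v ∈ S u := by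
        intro u v hu hv hux hvx cu cv cuv
        by_cases huv : v = u
        · rw [huv]; exact hSself u
        · refine hS u v hux.symm ⟨B.apartment_le A hA ?_, ?_⟩
          · rw [c.mem_faces_iff (by simp [hxA, hu, hv])]
            refine ⟨by simp, ?_⟩
            simp [cu, cv, cuv, cu.symm, cv.symm, cuv.symm, Close.refl]
          · exact Finset.card_eq_three.2 ⟨_, _, _, hux.symm, hvx.symm, Ne.symm huv, rfl⟩
      have ne_x : ∀ ν, ν ≠ c.coord x → c.vertexAt ν ≠ x := fun ν h hn => h (by
        rw [← hn, c.coord_vertexAt])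
      have hγA := c.vertexAt_mem γ
      have hδA := c.vertexAt_mem δ
      have cγ := c.coord_vertexAt γ
      have cδ := c.coord_vertexAt δ
      have hax := (c.pair_mem_iff haA hxA).1 (mem_of_subset hEA haE (by simp))
      have hyx' := (c.pair_mem_iff hyA hxA).1 hyx
      refine Finset.mem_biUnion.2 ⟨c.vertexAt δ, Finset.mem_biUnion.2 ⟨c.vertexAt γ, ?_, ?_⟩, ?_⟩
      · exact link _ _ haA hγA ha.1 (ne_x γ hγne) hax (by rwa [cγ]) (by rwa [cγ])
      · exact link _ _ hγA hδA (ne_x γ hγne) (ne_x δ hδne) (by rwa [cγ]) (by rwa [cδ])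
          (by rwa [cγ, cδ])
      · exact link _ _ hδA hyA (ne_x δ hδne) hy.1 (by rwa [cδ]) hyx' (by rwa [cδ])
    refine ⟨N.filter fun y => B.Adj y x, fun y => ?_, (Finset.card_filter_le _ _).trans hcard⟩
    rw [Finset.mem_filter]
    exact ⟨fun h => h.2, fun h => ⟨hsub y h, h⟩⟩
  · exact ⟨∅, fun y => by simpa using fun h => hne ⟨y, h⟩, by simp⟩

/-! ### The transition probabilities -/

theorem adj_of_mem_sphere {x y : V} (g : B.Frame x) {μ : Weight} (hμ : μ = (1, 0) ∨ μ = (0, 1))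
    (hy : y ∈ g.sphere μ) : B.Adj x y := by
  obtain ⟨r, hr, hD, ho, hrx, hrad⟩ := g.exists_isRetraction
  have h := hrad y μ hy
  obtain ⟨A, hA, hDA, hyA⟩ := B.exists_apartment_chamber_simplex hD (B.complex.singleton_mem y)
  obtain ⟨c, hc⟩ := hr A hA hDA
  have hxA := singleton_mem_of_mem hDA ho
  have h1 : Close (r x) (r y) ∧ r x ≠ r y := by
    rw [hrx]
    have h1 := congrArg Prod.fst h
    have h2 := congrArg Prod.snd h
    rcases hμ with rfl | rfl <;>
    · simp only [Close, dom, ne_eq, Prod.ext_iff, Prod.fst_zero, Prod.snd_zero] at *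
      omega
  refine ⟨fun h => h1.2 (by rw [h]), B.apartment_le A hA ?_⟩
  rw [c.pair_mem_iff hxA hyA, hc x hxA, hc y hyA]
  exact h1.1

/-- For adjacent vertices there is a frame at the first that turns the second into a fundamental
weight. -/
theorem exists_frame_of_adj {x y : V} (h : B.Adj x y) :
    (∃ g : B.Frame x, y ∈ g.sphere fundWeight₁) ∨ ∃ g : B.Frame x, y ∈ g.sphere fundWeight₂ := by
  obtain ⟨A, hA, hxy⟩ := B.exists_apartment _ h.2
  have hx : {x} ∈ A.faces := singleton_mem_of_mem hxy (by simp)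
  have hy : {y} ∈ A.faces := singleton_mem_of_mem hxy (by simp)
  obtain ⟨c⟩ := B.apartment_iso A hA
  obtain ⟨c₁, hc₁⟩ := exists_coord_sub c (c.coord x)
  obtain ⟨w, hw, hwy⟩ := exists_weyl_dom (c₁.coord y)
  obtain ⟨c₂, hc₂⟩ := exists_coord_weyl c₁ hw
  have hx₂ : c₂.coord x = 0 := by rw [hc₂ x hx, hc₁ x hx, sub_self, map_zero]
  have hy₂ : c₂.coord y = dom (c₂.coord y) := by rw [hc₂ y hy, dom_weyl hw, hwy]
  have hcl := (c₂.pair_mem_iff hx hy).1 hxy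
  have hne : c₂.coord x ≠ c₂.coord y := fun e => h.1 (c₂.coord_inj hx hy e)
  rw [hx₂] at hcl hne
  have hy3 : c₂.coord y = fundWeight₁ ∨ c₂.coord y = fundWeight₂ := by
    have := dom_nonneg (c₂.coord y)
    rw [← hy₂] at this
    simp only [fundWeight₁, fundWeight₂, Close, ne_eq, Prod.ext_iff, Prod.fst_zero,
      Prod.snd_zero] at *
    omega
  have hf : fundAlcove ∈ coxeterComplex.faces :=
    ⟨by simp [fundAlcove], 1, one_mem _, 0, by intro ν; simp⟩
  let g : B.Frame x :=
    { apartment := A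
      apartment_mem := hA
      origin_mem := hx
      chart := c₂
      chart_origin := by rw [← c₂.coord_eq hx, hx₂]
      chamber := fundAlcove.image c₂.vertexAt
      chamber_mem := c₂.image_vertexAt_mem hf
      mem_chamber_iff := fun v => by
        rw [← c₂.coord_eq v.2, Finset.mem_image]
        constructor
        · rintro ⟨μ, hμ, h⟩
          rwa [← h, c₂.coord_vertexAt]
        · intro h
          exact ⟨_, h, c₂.vertexAt_coord v.2⟩ }
  have hg : y ∈ g.sphere (c₂.coord y) := by
    refine ⟨?_, ?_, A, hA, g.chamber_mem, hy, SimplicialIso.refl A, fun v _ => rfl, 1, one_mem _, ?_⟩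
    · rw [hy₂]; exact (dom_nonneg _).1
    · rw [hy₂]; exact (dom_nonneg _).2
    · rw [c₂.coord_eq hy]; rfl
  rcases hy3 with e | e <;> rw [e] at hg
  exacts [Or.inl ⟨g, hg⟩, Or.inr ⟨g, hg⟩]

theorem qTranslation_rpow {q : ℕ} {μ : Weight} (hμ : μ = (1, 0) ∨ μ = (0, 1)) :
    qTranslation q μ ^ (-(1 / 2) : ℝ) = (q : ℝ)⁻¹ := by
  have h : qTranslation q μ = (q : ℝ) ^ (2 : ℕ) := by
    rcases hμ with rfl | rfl <;> simp only [qTranslation] <;> norm_cast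
  rw [h, ← Real.rpow_natCast, ← Real.rpow_mul (Nat.cast_nonneg q), ← Real.rpow_neg_one]
  norm_num

/-- The walk moves to each neighbour with the same probability. -/
theorem Frame.transition_eq {o : V} (f : B.Frame o) (q : ℕ) (x y : V) :
    f.transition q x y = if B.Adj x y then f.rho q * (q : ℝ)⁻¹ else 0 := by
  have e₁ := qTranslation_rpow (q := q) (μ := fundWeight₁) (Or.inl rfl)
  have e₂ := qTranslation_rpow (q := q) (μ := fundWeight₂) (Or.inr rfl)
  by_cases h : B.Adj x y
  · rw [if_pos h, Frame.transition, e₁, e₂]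
    by_cases h₁ : ∃ g : B.Frame x, y ∈ g.sphere fundWeight₁
    · rw [if_pos h₁, mul_comm]
    · rw [if_neg h₁, if_pos ((exists_frame_of_adj h).resolve_left h₁), mul_comm]
  · rw [if_neg h, Frame.transition, if_neg, if_neg]
    · rintro ⟨g, hg⟩; exact h (adj_of_mem_sphere g (Or.inr rfl) hg)
    · rintro ⟨g, hg⟩; exact h (adj_of_mem_sphere g (Or.inl rfl) hg)

theorem Frame.rho_nonneg {o : V} (f : B.Frame o) (q : ℕ) : 0 ≤ f.rho q := by
  have e₁ := qTranslation_rpow (q := q) (μ := fundWeight₁) (Or.inl rfl)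
  have e₂ := qTranslation_rpow (q := q) (μ := fundWeight₂) (Or.inr rfl)
  rw [Frame.rho, e₁, e₂]
  positivity

end Building

/-! ### Counting walks in a radial graph -/

/-- The number of walks of length `n` from `o` to `x` in the graph where `nb x` is the set of
neighbours of `x`. -/
def walkCount {V : Type*} (nb : V → Finset V) (o : V) : ℕ → V → ℕ
  | 0, x => if o = x then 1 else 0
  | n + 1, x => ∑ y ∈ nb x, walkCount nb o n y

/-- Adjacency in the dominant cone: `ν - μ` is one of the six weights `±λ₁`, `±λ₂`, `±(λ₁ - λ₂)`. -/
def ConeAdj (ν μ : ℕ × ℕ) : Prop :=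
  (ν.1 + 1 = μ.1 ∧ ν.2 = μ.2) ∨ (ν.1 = μ.1 ∧ ν.2 + 1 = μ.2) ∨
  (ν.1 + 1 = μ.1 ∧ ν.2 = μ.2 + 1) ∨ (ν.1 = μ.1 + 1 ∧ ν.2 + 1 = μ.2) ∨
  (ν.1 = μ.1 + 1 ∧ ν.2 = μ.2) ∨ (ν.1 = μ.1 ∧ ν.2 = μ.2 + 1)

/-- A graph with a projection `p` to the dominant cone, with the properties of the radial part that
determine the order of magnitude of the number of walks: the projection is simplicial, edges
lift, and edges that lead towards the origin `o` lift uniquely. -/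
structure IsRadialGraph {V : Type*} (nb : V → Finset V) (o : V) (p : V → ℕ × ℕ) (c : ℕ) :
    Prop where
  eq_origin : ∀ x, p x = (0, 0) → x = o
  map_origin : p o = (0, 0)
  coneAdj : ∀ x, ∀ y ∈ nb x, ConeAdj (p y) (p x)
  exists_lift : ∀ x ν, ConeAdj ν (p x) → ∃ y ∈ nb x, p y = ν
  unique_lift : ∀ x, ∀ y ∈ nb x, ∀ y' ∈ nb x, p y = p y' →
    (p y).1 + (p y).2 < (p x).1 + (p x).2 → y = y'
  card_le : ∀ x, (nb x).card ≤ c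

theorem choose_le_choose_add_add (M k s r : ℕ) (h : s ≤ r) :
    M.choose k ≤ (M + r).choose (k + s) := by
  obtain ⟨t, rfl⟩ := Nat.exists_eq_add_of_le h
  have h1 : M.choose k ≤ (M + s).choose (k + s) := by
    clear h
    induction s with
    | zero => exact le_rfl
    | succ s ih =>
      refine ih.trans ?_
      rw [← add_assoc, ← add_assoc, Nat.choose_succ_succ]
      exact Nat.le_add_right _ _
  exact h1.trans (Nat.choose_le_choose _ (by omega))

/-- If `b, d ≤ a`, then adding `2d` to both indices of `(a + b).choose (a - d)` changes it by a
bounded factor only: each unit step multiplies it by at most `2d + 1`. -/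
theorem choose_le_mul_choose {a b d : ℕ} (hba : b ≤ a) (hda : d ≤ a) :
    (a + b + 2 * d).choose (a + d) ≤ (2 * d + 1) ^ (2 * d) * (a + b).choose (a - d) := by
  obtain ⟨t, rfl⟩ := Nat.exists_eq_add_of_le hda
  rcases Nat.eq_zero_or_pos d with rfl | hd
  · simp
  have key : ∀ m, (d + t + b + m).choose (t + m) ≤
      (2 * d + 1) ^ m * (d + t + b).choose t := by
    intro m
    induction m with
    | zero => simp
    | succ m ih =>
      have h1 := Nat.add_one_mul_choose_eq (d + t + b + m) (t + m)
      have h2 : d + t + b + m + 1 ≤ (2 * d + 1) * (t + m + 1) := by nlinarith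
      have h3 : (d + t + b + m + 1).choose (t + m + 1) * (t + m + 1) ≤
          ((2 * d + 1) ^ (m + 1) * (d + t + b).choose t) * (t + m + 1) := by
        rw [← h1]
        calc (d + t + b + m + 1) * (d + t + b + m).choose (t + m)
            ≤ ((2 * d + 1) * (t + m + 1)) * ((2 * d + 1) ^ m * (d + t + b).choose t) :=
              Nat.mul_le_mul h2 ih
          _ = _ := by ring
      exact Nat.le_of_mul_le_mul_right h3 (by omega)
  have := key (2 * d)
  rwa [show d + t + d = t + 2 * d by ring, show d + t - d = t by omega]

namespace IsRadialGraph

variable {V : Type*} {nb : V → Finset V} {o : V} {p : V → ℕ × ℕ} {c : ℕ}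

theorem swap (h : IsRadialGraph nb o p c) : IsRadialGraph nb o (fun x => (p x).swap) c where
  eq_origin x hx := h.eq_origin x (by simpa [Prod.ext_iff, and_comm] using hx)
  map_origin := by simp [h.map_origin]
  coneAdj x y hy := by
    have := h.coneAdj x y hy
    simp only [ConeAdj, Prod.fst_swap, Prod.snd_swap] at *
    omega
  exists_lift x ν hν := by
    obtain ⟨y, hy, hyν⟩ := h.exists_lift x ν.swap (by
      simp only [ConeAdj, Prod.fst_swap, Prod.snd_swap] at *
      omega)
    exact ⟨y, hy, by rw [hyν, Prod.swap_swap]⟩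
  unique_lift x y hy y' hy' he hlt := h.unique_lift x y hy y' hy' (Prod.swap_injective he) (by
    simp only [Prod.fst_swap, Prod.snd_swap] at hlt
    omega)
  card_le := h.card_le

theorem walkCount_eq_zero (h : IsRadialGraph nb o p c) (n : ℕ) (x : V)
    (hlt : n < (p x).1 + (p x).2) : walkCount nb o n x = 0 := by
  induction n generalizing x with
  | zero =>
    rw [walkCount, if_neg]
    rintro rfl
    simp [h.map_origin] at hlt
  | succ n ih =>
    rw [walkCount]
    refine Finset.sum_eq_zero fun y hy => ih y ?_
    have := h.coneAdj x y hy
    simp only [ConeAdj] at this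
    omega

/-- Upper bound for the number of walks. Read backwards from `x`, a walk of length `n = x₁ + x₂ + d`
has at most `d` steps that do not lead towards the origin; each of these has at most `c` choices
and at most `n` positions, while the steps towards the origin amount to a walk in `ℕ × ℕ`. -/
theorem walkCount_le (h : IsRadialGraph nb o p c) (hc : 1 ≤ c) (n d : ℕ) (x : V)
    (hn : n = (p x).1 + (p x).2 + d) :
    walkCount nb o n x ≤
      c ^ d * n ^ d * ((p x).1 + (p x).2 + 2 * d).choose ((p x).1 + d) := by
  induction n generalizing x d with
  | zero =>
    have h1 : (p x).1 = 0 := by omega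
    have h2 : (p x).2 = 0 := by omega
    have h3 : d = 0 := by omega
    subst h3
    rw [h1, h2, walkCount]
    split_ifs <;> simp
  | succ n ih =>
    obtain ⟨a, ha⟩ : ∃ a, (p x).1 = a := ⟨_, rfl⟩
    obtain ⟨b, hb⟩ : ∃ b, (p x).2 = b := ⟨_, rfl⟩
    rw [ha, hb] at hn ⊢
    set T := (a + b + 2 * d).choose (a + d) with hT
    let S₁ := (nb x).filter fun y => (p y).1 + 1 = a ∧ (p y).2 = b
    let S₂ := (nb x).filter fun y => (p y).1 = a ∧ (p y).2 + 1 = b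
    have hS : ∀ S : Finset V, S ⊆ nb x → (∀ y ∈ S, ∀ y' ∈ S, p y = p y') →
        (∀ y ∈ S, (p y).1 + (p y).2 < a + b) → S.card ≤ 1 := by
      intro S hS he hlt
      refine Finset.card_le_one.2 fun y hy y' hy' => ?_
      refine h.unique_lift x y (hS hy) y' (hS hy') (he y hy y' hy') ?_
      rw [ha, hb]
      exact hlt y hy
    have hS₁ : S₁.card ≤ 1 := by
      refine hS S₁ (Finset.filter_subset _ _) (fun y hy y' hy' => ?_) (fun y hy => ?_)
      · have h1 := (Finset.mem_filter.1 hy).2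
        have h2 := (Finset.mem_filter.1 hy').2
        ext <;> omega
      · have h1 := (Finset.mem_filter.1 hy).2
        omega
    have hS₂ : S₂.card ≤ 1 := by
      refine hS S₂ (Finset.filter_subset _ _) (fun y hy y' hy' => ?_) (fun y hy => ?_)
      · have h1 := (Finset.mem_filter.1 hy).2
        have h2 := (Finset.mem_filter.1 hy').2
        ext <;> omega
      · have h1 := (Finset.mem_filter.1 hy).2
        omega
    -- the contribution of the at most two neighbours nearer to the origin, by Pascal's rule
    have near : ∑ y ∈ S₁, walkCount nb o n y + ∑ y ∈ S₂, walkCount nb o n y ≤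
        c ^ d * n ^ d * T := by
      have b₁ : ∀ y ∈ S₁, walkCount nb o n y ≤
          c ^ d * n ^ d * (a + b + 2 * d - 1).choose (a + d - 1) := by
        intro y hy
        have h1 := (Finset.mem_filter.1 hy).2
        refine (ih d y (by omega)).trans (le_of_eq ?_)
        congr 2 <;> omega
      have b₂ : ∀ y ∈ S₂, walkCount nb o n y ≤
          c ^ d * n ^ d * (a + b + 2 * d - 1).choose (a + d) := by
        intro y hy
        have h1 := (Finset.mem_filter.1 hy).2
        refine (ih d y (by omega)).trans (le_of_eq ?_)
        congr 2 <;> omega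
      have e₁ : ∑ y ∈ S₁, walkCount nb o n y ≤
          c ^ d * n ^ d * (a + b + 2 * d - 1).choose (a + d - 1) :=
        (Finset.sum_le_card_nsmul _ _ _ b₁).trans (by
          rw [smul_eq_mul]; exact (Nat.mul_le_mul_right _ hS₁).trans (one_mul _).le)
      have e₂ : ∑ y ∈ S₂, walkCount nb o n y ≤
          c ^ d * n ^ d * (a + b + 2 * d - 1).choose (a + d) :=
        (Finset.sum_le_card_nsmul _ _ _ b₂).trans (by
          rw [smul_eq_mul]; exact (Nat.mul_le_mul_right _ hS₂).trans (one_mul _).le)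
      by_cases h0 : a + d = 0
      · -- here `a = 0`, so no neighbour is nearer in the first coordinate
        have : S₁ = ∅ := by
          refine Finset.filter_eq_empty_iff.2 fun y _ hy => ?_
          omega
        rw [this, Finset.sum_empty, zero_add]
        refine e₂.trans (Nat.mul_le_mul_left _ (Nat.choose_le_choose _ (by omega)))
      · refine (add_le_add e₁ e₂).trans (le_of_eq ?_)
        obtain ⟨k, hk⟩ := Nat.exists_eq_succ_of_ne_zero h0
        obtain ⟨M, hM⟩ := Nat.exists_eq_succ_of_ne_zero (show a + b + 2 * d ≠ 0 by omega)
        rw [hT, hk, hM, Nat.succ_sub_one, Nat.succ_sub_one, Nat.choose_succ_succ, mul_add]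
    -- the contribution of the other neighbours, each of which uses up some of the excess `d`
    have far : ∀ y ∈ nb x, ¬ ((p y).1 + 1 = a ∧ (p y).2 = b) →
        ¬ ((p y).1 = a ∧ (p y).2 + 1 = b) →
        walkCount nb o n y * (n + 1) ≤ c ^ (d - 1) * (n + 1) ^ d * T := by
      intro y hy h1 h2
      have hadj := h.coneAdj x y hy
      simp only [ConeAdj, ha, hb] at hadj
      by_cases hlt : n < (p y).1 + (p y).2
      · rw [h.walkCount_eq_zero n y hlt]; simp
      obtain ⟨e, he⟩ := Nat.exists_eq_add_of_le (not_lt.1 hlt)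
      have hed : e ≤ d - 1 := by omega
      have hch : ((p y).1 + (p y).2 + 2 * e).choose ((p y).1 + e) ≤ T := by
        obtain ⟨s, hs⟩ := Nat.exists_eq_add_of_le (show (p y).1 + e ≤ a + d by omega)
        obtain ⟨r, hr⟩ := Nat.exists_eq_add_of_le
          (show (p y).1 + (p y).2 + 2 * e ≤ a + b + 2 * d by omega)
        rw [hT, hs, hr]
        exact choose_le_choose_add_add _ _ _ _ (by omega)
      calc walkCount nb o n y * (n + 1)
          ≤ (c ^ e * n ^ e * ((p y).1 + (p y).2 + 2 * e).choose ((p y).1 + e)) * (n + 1) :=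
            Nat.mul_le_mul_right _ (ih e y he)
        _ ≤ (c ^ (d - 1) * (n + 1) ^ (d - 1) * T) * (n + 1) := by
            exact Nat.mul_le_mul_right _ (Nat.mul_le_mul (Nat.mul_le_mul
              (Nat.pow_le_pow_right hc hed) ((Nat.pow_le_pow_left (Nat.le_succ n) _).trans
                (Nat.pow_le_pow_right (Nat.succ_pos n) hed))) hch)
        _ = c ^ (d - 1) * (n + 1) ^ (d - 1 + 1) * T := by ring
        _ = c ^ (d - 1) * (n + 1) ^ d * T := by
            rw [Nat.sub_add_cancel (show 1 ≤ d by omega)]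
    rw [walkCount]
    let S₃ := (nb x).filter fun y =>
      ¬ ((p y).1 + 1 = a ∧ (p y).2 = b) ∧ ¬ ((p y).1 = a ∧ (p y).2 + 1 = b)
    have split : ∑ y ∈ nb x, walkCount nb o n y ≤
        (∑ y ∈ S₁, walkCount nb o n y + ∑ y ∈ S₂, walkCount nb o n y) +
          ∑ y ∈ S₃, walkCount nb o n y := by
      simp only [S₁, S₂, S₃, Finset.sum_filter, ← Finset.sum_add_distrib]
      refine Finset.sum_le_sum fun y _ => ?_
      split_ifs <;> omega
    rcases Nat.eq_zero_or_pos d with rfl | hd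
    · have h3 : ∑ y ∈ S₃, walkCount nb o n y = 0 := by
        refine Finset.sum_eq_zero fun y hy => h.walkCount_eq_zero n y ?_
        obtain ⟨hy, h1, h2⟩ := Finset.mem_filter.1 hy
        have hadj := h.coneAdj x y hy
        simp only [ConeAdj, ha, hb] at hadj
        omega
      simp only [pow_zero] at near ⊢
      omega
    · obtain ⟨d, rfl⟩ := Nat.exists_eq_succ_of_ne_zero hd.ne'
      have h3 : ∑ y ∈ S₃, walkCount nb o n y ≤ c * (c ^ d * (n + 1) ^ d * T) := by
        refine (Finset.sum_le_card_nsmul _ _ (c ^ d * (n + 1) ^ d * T) fun y hy => ?_).trans ?_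
        · obtain ⟨hy, h1, h2⟩ := Finset.mem_filter.1 hy
          refine Nat.le_of_mul_le_mul_right ((far y hy h1 h2).trans (le_of_eq ?_))
            (Nat.succ_pos n)
          simp only [Nat.succ_eq_add_one, Nat.add_sub_cancel]
          ring
        · rw [smul_eq_mul]
          exact Nat.mul_le_mul_right _ ((Finset.card_filter_le _ _).trans (h.card_le x))
      calc _ ≤ c ^ (d + 1) * n ^ (d + 1) * T + c * (c ^ d * (n + 1) ^ d * T) :=
            split.trans (add_le_add near h3)
        _ ≤ c ^ (d + 1) * (n * (n + 1) ^ d) * T + c * (c ^ d * (n + 1) ^ d * T) := by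
            gcongr
            rw [pow_succ, mul_comm]
            exact Nat.mul_le_mul_left _ (Nat.pow_le_pow_left (by omega) _)
        _ = c ^ (d + 1) * (n + 1) ^ (d + 1) * T := by ring

/-- Lower bound for the number of walks: the left-hand side counts the lattice paths
that, read backwards from the radial part of `x`, have `d` steps `-λ₁ + λ₂`, `i` steps `-λ₁`,
`j + d` steps `-λ₂` and stay in the dominant cone. The count is a multinomial coefficient times the ballot fraction `(j + 1) / (j + d + 1)`. -/
theorem le_walkCount (h : IsRadialGraph nb o p c) (n d i j : ℕ) (x : V) (hx : p x = (i + d, j))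
    (hn : n = 2 * d + i + j) :
    ((n.factorial * (j + 1) : ℕ) : ℝ) / (d.factorial * i.factorial * (j + d + 1).factorial : ℕ) ≤
      walkCount nb o n x := by
  induction n generalizing d i j x with
  | zero =>
    obtain rfl : d = 0 := by omega
    obtain rfl : i = 0 := by omega
    obtain rfl : j = 0 := by omega
    rw [walkCount, if_pos (h.eq_origin x hx).symm]
    simp
  | succ n ih =>
    obtain ⟨M, hM⟩ : ∃ M : ℝ,
        M = n.factorial / (d.factorial * i.factorial * (j + d + 1).factorial : ℕ) :=
      ⟨_, rfl⟩
    have single : ∀ (q : V → Prop) [DecidablePred q] (r : ℝ),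
        r ≤ 0 ∨ (∃ y ∈ nb x, q y ∧ r ≤ walkCount nb o n y) →
        r ≤ ∑ y ∈ nb x, if q y then (walkCount nb o n y : ℝ) else 0 := by
      rintro q _ r (hr | ⟨y, hy, hq, hr⟩)
      · refine hr.trans (Finset.sum_nonneg fun y _ => ?_)
        split_ifs <;> positivity
      · refine hr.trans ?_
        refine le_trans (le_of_eq (if_pos hq).symm) (Finset.single_le_sum
          (f := fun y => if q y then (walkCount nb o n y : ℝ) else 0) (fun y _ => ?_) hy)
        split_ifs <;> positivity
    have t₁ := single (fun y => (p y).1 + 1 = i + d ∧ (p y).2 = j) (i * (j + 1) * M) (by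
      rcases i with _ | i
      · left; simp
      · right
        obtain ⟨y, hy, hyp⟩ := h.exists_lift x (i + d, j) (by
          rw [hx]; exact Or.inl ⟨by dsimp only; omega, rfl⟩)
        refine ⟨y, hy, by rw [hyp]; exact ⟨by dsimp only; omega, rfl⟩, ?_⟩
        refine le_trans (le_of_eq ?_) (ih d i j y hyp (by omega))
        rw [hM, Nat.factorial_succ i]
        push_cast
        field_simp)
    have t₂ := single (fun y => (p y).1 = i + d ∧ (p y).2 + 1 = j) (j * (j + d + 1) * M) (by
      rcases j with _ | j
      · left; simp
      · right
        obtain ⟨y, hy, hyp⟩ := h.exists_lift x (i + d, j) (by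
          rw [hx]; exact Or.inr (Or.inl ⟨rfl, rfl⟩))
        refine ⟨y, hy, by rw [hyp]; simp, ?_⟩
        refine le_trans (le_of_eq ?_) (ih d i j y hyp (by omega))
        rw [hM, show j + 1 + d + 1 = (j + d + 1) + 1 by ring, Nat.factorial_succ (j + d + 1)]
        push_cast
        field_simp
        ring)
    have t₃ := single (fun y => (p y).1 + 1 = i + d ∧ (p y).2 = j + 1) (d * (j + 2) * M) (by
      rcases d with _ | d
      · left; simp
      · right
        obtain ⟨y, hy, hyp⟩ := h.exists_lift x (i + d, j + 1) (by
          rw [hx]; exact Or.inr (Or.inr (Or.inl ⟨by dsimp only; omega, rfl⟩)))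
        refine ⟨y, hy, by rw [hyp]; exact ⟨by dsimp only; omega, rfl⟩, ?_⟩
        refine le_trans (le_of_eq ?_) (ih d i (j + 1) y hyp (by omega))
        rw [hM, show j + (d + 1) + 1 = j + 1 + d + 1 by ring, Nat.factorial_succ d]
        push_cast
        field_simp
        ring)
    have split : (∑ y ∈ nb x, if (p y).1 + 1 = i + d ∧ (p y).2 = j then
          (walkCount nb o n y : ℝ) else 0) +
        (∑ y ∈ nb x, if (p y).1 = i + d ∧ (p y).2 + 1 = j then
          (walkCount nb o n y : ℝ) else 0) +
        (∑ y ∈ nb x, if (p y).1 + 1 = i + d ∧ (p y).2 = j + 1 then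
          (walkCount nb o n y : ℝ) else 0) ≤ walkCount nb o (n + 1) x := by
      rw [walkCount, Nat.cast_sum, ← Finset.sum_add_distrib, ← Finset.sum_add_distrib]
      refine Finset.sum_le_sum fun y _ => ?_
      have : (0 : ℝ) ≤ walkCount nb o n y := Nat.cast_nonneg _
      split_ifs <;> linarith
    -- the recurrence `(2d + i + j)(j + 1) = i(j + 1) + j(j + d + 1) + d(j + 2)`
    have hrec : (((n + 1).factorial * (j + 1) : ℕ) : ℝ) /
        (d.factorial * i.factorial * (j + d + 1).factorial : ℕ) =
        i * (j + 1) * M + j * (j + d + 1) * M + d * (j + 2) * M := by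
      have hn' : (n : ℝ) + 1 = 2 * d + i + j := by exact_mod_cast hn
      rw [hM, Nat.factorial_succ]
      push_cast
      rw [hn']
      field_simp
      ring
    rw [hrec]
    linarith

/-- The number of walks of length `n = a + b + d` to a vertex with radial part `a λ₁ + b λ₂` is
comparable to `n ^ d * (n - d).choose (a - d)`, if `b, d ≤ a`. -/
theorem walkCount_bounds (h : IsRadialGraph nb o p c) (hc : 1 ≤ c) {x : V} {n d a b : ℕ}
    (hx : p x = (a, b)) (hba : b ≤ a) (hda : d ≤ a) (hn : n = a + b + d) :
    (n : ℝ) ^ d * ((n - d).choose (a - d) : ℝ) ≤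
        ((d + 1) ^ (d + 1) * d.factorial : ℕ) * (walkCount nb o n x : ℝ) ∧
      (walkCount nb o n x : ℝ) ≤
        (c ^ d * (2 * d + 1) ^ (2 * d) : ℕ) * ((n : ℝ) ^ d * ((n - d).choose (a - d) : ℝ)) := by
  constructor
  · obtain ⟨i, rfl⟩ := Nat.exists_eq_add_of_le' hda
    have h1 := h.le_walkCount n d i b x hx (by omega)
    have hpos : (0 : ℝ) < ((d + 1) ^ (d + 1) * d.factorial : ℕ) := by positivity
    refine le_trans ?_ (mul_le_mul_of_nonneg_left h1 hpos.le)
    rw [Nat.add_sub_cancel, ← mul_div_assoc, le_div_iff₀ (by positivity)]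
    norm_cast
    -- `n! / (n - d)!` is at least `(n + 1 - d) ^ d`, hence at least `(n / (d + 1)) ^ d`
    have h2 : n ^ d ≤ (d + 1) ^ d * n.descFactorial d := by
      refine le_trans ?_ (Nat.mul_le_mul_left _ (Nat.pow_sub_le_descFactorial n d))
      rw [← mul_pow]
      refine Nat.pow_le_pow_left ?_ _
      obtain ⟨e, he⟩ : ∃ e, n = d + e := ⟨n - d, by omega⟩
      rw [he, show d + e + 1 - d = e + 1 by omega]
      nlinarith
    have h3 : (n - d).factorial * n.descFactorial d = n.factorial :=
      Nat.factorial_mul_descFactorial (by omega)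
    have h4 : (n - d).choose i * i.factorial * (b + d).factorial = (n - d).factorial := by
      have := Nat.choose_mul_factorial_mul_factorial (show i ≤ n - d by omega)
      rwa [show n - d - i = b + d by omega] at this
    have h5 : b + d + 1 ≤ (d + 1) * (b + 1) := by nlinarith
    rw [Nat.factorial_succ (b + d)]
    calc n ^ d * (n - d).choose i * (d.factorial * i.factorial * ((b + d + 1) * (b + d).factorial))
        = n ^ d * ((n - d).choose i * i.factorial * (b + d).factorial) * d.factorial *
            (b + d + 1) := by ring
      _ = n ^ d * (n - d).factorial * d.factorial * (b + d + 1) := by rw [h4]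
      _ ≤ ((d + 1) ^ d * n.descFactorial d) * (n - d).factorial * d.factorial *
            ((d + 1) * (b + 1)) := by gcongr
      _ = (d + 1) ^ (d + 1) * d.factorial *
            (((n - d).factorial * n.descFactorial d) * (b + 1)) := by ring
      _ = _ := by rw [h3]
  · have h1 := h.walkCount_le hc n d x (by rw [hx]; exact hn)
    rw [hx] at h1
    have h2 := choose_le_mul_choose hba hda
    have h3 : walkCount nb o n x ≤
        (c ^ d * (2 * d + 1) ^ (2 * d)) * (n ^ d * (n - d).choose (a - d)) := by
      rw [show n - d = a + b by omega]
      calc _ ≤ c ^ d * n ^ d * (a + b + 2 * d).choose (a + d) := h1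
        _ ≤ c ^ d * n ^ d * ((2 * d + 1) ^ (2 * d) * (a + b).choose (a - d)) := by gcongr
        _ = _ := by ring
    exact_mod_cast h3

end IsRadialGraph

/-! ### The building as a radial graph -/

namespace Building

variable {V : Type*} {B : Building V}

theorem Frame.nStep_eq {o : V} (f : B.Frame o) (q : ℕ) {nb : V → Finset V}
    (hnb : ∀ x y, y ∈ nb x ↔ B.Adj y x) (n : ℕ) (x : V) :
    f.nStep q n o x = (f.rho q * (q : ℝ)⁻¹) ^ n * walkCount nb o n x := by
  induction n generalizing x with
  | zero =>
    rw [Frame.nStep, walkCount]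
    split_ifs <;> simp
  | succ n ih =>
    rw [Frame.nStep, walkCount, tsum_eq_sum (s := nb x), Nat.cast_sum, Finset.mul_sum]
    · refine Finset.sum_congr rfl fun z hz => ?_
      rw [ih, f.transition_eq, if_pos ((hnb x z).1 hz)]
      ring
    · intro z hz
      rw [f.transition_eq, if_neg fun h => hz ((hnb x z).2 h), mul_zero]

/-- The graph of a regular building is a radial graph over the dominant cone, by the radial part. -/
theorem Frame.exists_isRadialGraph {q : ℕ} (hq : B.IsRegular q) {o : V} (f : B.Frame o) :
    ∃ (nb : V → Finset V) (p : V → ℕ × ℕ), (∀ x y, y ∈ nb x ↔ B.Adj y x) ∧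
      IsRadialGraph nb o p ((q + 2) ^ 3) ∧
      ∀ x (x₁ x₂ : ℕ), x ∈ f.sphere (x₁ • fundWeight₁ + x₂ • fundWeight₂) → p x = (x₁, x₂) := by
  obtain ⟨r, hr, hD, ho, hro, hrad⟩ := f.exists_isRetraction
  choose nb hnb hcard using exists_neighborFinset hq
  have h1 : ∀ x, (((dom (r x)).1.toNat : ℕ) : ℤ) = (dom (r x)).1 := fun x =>
    Int.toNat_of_nonneg (dom_nonneg _).1
  have h2 : ∀ x, (((dom (r x)).2.toNat : ℕ) : ℤ) = (dom (r x)).2 := fun x =>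
    Int.toNat_of_nonneg (dom_nonneg _).2
  refine ⟨nb, fun x => ((dom (r x)).1.toNat, (dom (r x)).2.toNat), hnb, ?_, ?_⟩
  · constructor
    · intro x hx
      refine hr.eq_of_mem hD ho ?_
      rw [hro]
      apply dom_eq_zero
      have := h1 x
      have := h2 x
      simp only [Prod.ext_iff] at hx
      ext
      · simp only [Prod.fst_zero]; omega
      · simp only [Prod.snd_zero]; omega
    · rw [hro]; rfl
    · intro x y hy
      obtain ⟨hc, hne⟩ := hr.close hD ((hnb x y).1 hy)
      have hne' := dom_ne_dom hc hne
      have hc' := hc.dom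
      have := h1 x
      have := h2 x
      have := h1 y
      have := h2 y
      simp only [ConeAdj, Close, ne_eq, Prod.ext_iff] at *
      omega
    · intro x ν hν
      have e1 := h1 x
      have e2 := h2 x
      obtain ⟨y, hy, hyν⟩ := hr.exists_adj hD x (ν := ((ν.1 : ℤ), (ν.2 : ℤ)))
        (Int.natCast_nonneg _) (Int.natCast_nonneg _)
        (by simp only [ConeAdj, Close] at *; omega)
        (by simp only [ConeAdj, ne_eq, Prod.ext_iff] at *; omega)
      exact ⟨y, (hnb x y).2 hy, by rw [hyν]; simp⟩
    · intro x y hy y' hy' he hlt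
      have := h1 x
      have := h2 x
      have := h1 y
      have := h2 y
      have := h1 y'
      have := h2 y'
      refine hr.eq_of_height_lt hD ho hro ((hnb x y).1 hy) ((hnb x y').1 hy') ?_ ?_
      · simp only [Prod.ext_iff] at *
        omega
      · simp only [height] at *
        omega
    · exact hcard
  · intro x x₁ x₂ hx
    have := hrad x _ hx
    simp only [← this]
    simp [fundWeight₁, fundWeight₂]

end Building

end A2

end

theorem theorem3p2 (q : ℕ) (hq : 2 ≤ q) (K : ℝ) (hK : 0 < K) :
    ∃ C : ℝ, 0 < C ∧
      ∀ (V : Type*) (B : A2.Building V), B.IsRegular q →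
        ∀ (o : V) (f : B.Frame o) (x : V) (x₁ x₂ n d : ℕ),
          x ∈ f.sphere (x₁ • A2.fundWeight₁ + x₂ • A2.fundWeight₂) →
          x₁ + x₂ ≤ n → (n : ℝ) - K ≤ ((x₁ + x₂ : ℕ) : ℝ) → d = n - (x₁ + x₂) →
          d ≤ max x₁ x₂ →
            1 / C * ((n : ℝ) ^ d * (f.rho q * (q : ℝ)⁻¹) ^ n *
                ((n - d).choose (max x₁ x₂ - d) : ℝ)) ≤ f.nStep q n o x ∧
            f.nStep q n o x ≤ C * ((n : ℝ) ^ d * (f.rho q * (q : ℝ)⁻¹) ^ n *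
                ((n - d).choose (max x₁ x₂ - d) : ℝ)) := by
  set c := (q + 2) ^ 3 with hc
  have hc1 : 1 ≤ c := Nat.one_le_pow _ _ (by omega)
  set D := ⌊K⌋₊ with hD
  let C₁ : ℕ := (D + 1) ^ (D + 1) * D.factorial
  let C₂ : ℕ := c ^ D * (2 * D + 1) ^ (2 * D)
  have hC₁ : (0 : ℝ) < C₁ := by positivity
  refine ⟨C₁ + C₂, by positivity, ?_⟩
  intro V B hB o f x x₁ x₂ n d hx hxn hnK hd hdmax
  have hdD : d ≤ D := by
    refine Nat.le_floor ?_
    rw [hd, Nat.cast_sub hxn]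
    linarith
  have hd₁ : (d + 1) ^ (d + 1) * d.factorial ≤ C₁ :=
    Nat.mul_le_mul ((Nat.pow_le_pow_left (by omega) _).trans
      (Nat.pow_le_pow_right (by omega) (by omega))) (Nat.factorial_le hdD)
  have hd₂ : c ^ d * (2 * d + 1) ^ (2 * d) ≤ C₂ :=
    Nat.mul_le_mul (Nat.pow_le_pow_right hc1 hdD) ((Nat.pow_le_pow_left (by omega) _).trans
      (Nat.pow_le_pow_right (by omega) (by omega)))
  obtain ⟨nb, p, hnb, hrad, hp⟩ := f.exists_isRadialGraph hB
  have hpx := hp x x₁ x₂ hx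
  have hβ : 0 ≤ (f.rho q * (q : ℝ)⁻¹) ^ n :=
    pow_nonneg (mul_nonneg (f.rho_nonneg q) (by positivity)) n
  rw [f.nStep_eq q hnb]
  set β := (f.rho q * (q : ℝ)⁻¹) ^ n
  set W : ℝ := (A2.walkCount nb o n x : ℝ) with hW
  set R : ℝ := (n : ℝ) ^ d * ((n - d).choose (max x₁ x₂ - d) : ℝ) with hR
  have hR0 : 0 ≤ R := by positivity
  have hW0 : 0 ≤ W := Nat.cast_nonneg _
  have key : R ≤ ((d + 1) ^ (d + 1) * d.factorial : ℕ) * W ∧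
      W ≤ (c ^ d * (2 * d + 1) ^ (2 * d) : ℕ) * R := by
    rcases le_total x₂ x₁ with h | h
    · rw [hR, max_eq_left h]
      exact hrad.walkCount_bounds hc1 hpx h (by rwa [max_eq_left h] at hdmax) (by omega)
    · rw [hR, max_eq_right h]
      exact hrad.swap.walkCount_bounds hc1 (a := x₂) (b := x₁) (by rw [hpx]; rfl) h
        (by rwa [max_eq_right h] at hdmax) (by omega)
  have k1 : R ≤ (C₁ + C₂) * W := key.1.trans (mul_le_mul_of_nonneg_right (by
    have : (((d + 1) ^ (d + 1) * d.factorial : ℕ) : ℝ) ≤ C₁ := by exact_mod_cast hd₁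
    have : (0 : ℝ) ≤ C₂ := Nat.cast_nonneg _
    linarith) hW0)
  have k2 : W ≤ (C₁ + C₂) * R := key.2.trans (mul_le_mul_of_nonneg_right (by
    have : ((c ^ d * (2 * d + 1) ^ (2 * d) : ℕ) : ℝ) ≤ C₂ := by exact_mod_cast hd₂
    linarith) hR0)
  have hR' : (n : ℝ) ^ d * β * ((n - d).choose (max x₁ x₂ - d) : ℝ) = β * R := by
    rw [hR]; ring
  rw [hR']
  constructor
  · rw [one_div, inv_mul_le_iff₀ (by positivity)]
    calc β * R ≤ β * ((C₁ + C₂) * W) := mul_le_mul_of_nonneg_left k1 hβ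
      _ = _ := by ring
  · calc β * W ≤ β * ((C₁ + C₂) * R) := mul_le_mul_of_nonneg_left k2 hβ
      _ = _ := by ring
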